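/- Let $L$ be a lattice of rank $n\ge 1$, $L^*=\mathrm{Hom}(L,\mathbb Z)$ and $L_{\mathbb R}=L\otimes\mathbb R$. A simplicial multi-fan $\Delta=(\Sigma,C,w^{\pm})$ of dimension $n$ in $L$ consists of a finite augmented simplicial complex $\Sigma$ (with $\emptyset\in\Sigma$ and vertex set $\Sigma^{(1)}$; $\Sigma^{(k)}$ denotes the set of simplices with $k$ vertices), a primitive vector $v_i\in L$ for each vertex $i$, such that $\{v_i\}_{i\in I}$ is linearly independent for every $I\in\Sigma$, the cones $C(I)\subset L_{\mathbb R}$ generated by $\{v_i\}_{i\in I}$, and functions $w^\pm:\Sigma^{(n)}\to\mathbb Z_{\ge0}$; it is assumed that $\Sigma^{(n)}\neq\emptyset$. Put $w=w^+-w^-$. For $K\in\Sigma$ and $K\subset J\in\Sigma$ let $C_K(J)$ be the image of $C(J)$ in $L_{\mathbb R}/\langle C(K)\rangle$. A vector of this quotient is generic if it lies on no linear span of a cone $C_K(J)$ with $K\subset J\in\Sigma$, $|J|<n$. $\Delta$ is complete if for every $K\in\Sigma$ the integer $\sum_{I\in\Sigma^{(n)},\,I\supset K,\,x\in C_K(I)}w(I)$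 does not depend on the generic vector $x$; it is non-singular if $\{v_i\}_{i\in I}$ is a basis of $L$ for every $I\in\Sigma^{(n)}$, in which case $\{u_i^I\}_{i\in I}\subset L^*$ denotes the dual basis. Let $H_T^*(\Delta)=\mathbb Z[x_i\mid i\in\Sigma^{(1)}]/(\prod_{i\in J}x_i\mid J\notin\Sigma)$, let $H_T^2(\Delta)$ be its part spanned by the $x_i$, and map $L^*$ to $H_T^2(\Delta)$ by $u\mapsto\sum_i\langle u,v_i\rangle x_i$. The first Chern class $c_1(\Delta)$ is the class of $\sum_i x_i$ in $H_T^2(\Delta)/L^*$. Let $\Delta$ be a complete non-singular multi-fan of dimension $n\ge1$. Its equivariant $T_y$-genus $$\sum_{I\in\Sigma^{(n)}}w(I)\prod_{i\in I}\frac{1+y\,t^{-u_i^I}}{1-t^{-u_i^I}},$$ a polynomial in $y$ over the fraction field of the group ring $\mathbb Z[L^*]$ (with basis $t^u$, $u\in L^*$), is constant, that is, it equals a unique polynomial $T_y[\Delta]\in\mathbb Z[y]$, the $T_y$-genus of $\Delta$; $T_0[\Delta]$ is called the Todd genus. Suppose that $T_0[\Delta]\ne0$ and that $c_1(\Delta)$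 is divisible by a positive integer $N$. Then $N\le n+1$. If $N=n+1$, then $$T_y[\Delta]=T_0[\Delta]\sum_{k=0}^{n}(-y)^k,$$ and if $N=n$, then $$T_y[\Delta]=T_0[\Delta]\,(1-y)\sum_{k=0}^{n-1}(-y)^k.$$ -/

import Mathlib

open scoped TensorProduct
open Polynomial

noncomputable section

/-- A simplicial multi-fan `Δ = (Σ, C, w⁺, w⁻)` in the lattice `L`, of dimension the rank of `L`.
`Σ` is an augmented simplicial complex with (finite) vertex set `V = Σ⁽¹⁾`, given by its set `faces`
of simplices (the empty simplex included).  A simplicial rational cone is the same thing as the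
linearly independent set of the primitive generators of its rays, so the map `C` is recorded by the
primitive generator `edge i` of each ray `C(i)`; then `C(I)` is `SimplicialMultiFan.cone`. -/
structure SimplicialMultiFan (L : Type*) [AddCommGroup L] (V : Type*) where
  /-- the simplices, the empty one included -/
  faces : Finset (Finset V)
  empty_mem : ∅ ∈ faces
  singleton_mem : ∀ i : V, {i} ∈ faces
  down_closed : ∀ I ∈ faces, ∀ J ⊆ I, J ∈ faces
  /-- the primitive edge vectors `v_i` -/
  edge : V → L
  edge_primitive : ∀ (i : V) (m : ℤ) (x : L), edge i = m • x → IsUnit m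
  edge_linearIndependent : ∀ I ∈ faces, LinearIndependent ℤ (fun i : I => edge i)
  /-- `w⁺`; only its values on simplices with `rank L` vertices matter -/
  wPos : Finset V → ℕ
  /-- `w⁻`; only its values on simplices with `rank L` vertices matter -/
  wNeg : Finset V → ℕ
  exists_facet : ∃ I ∈ faces, I.card = Module.finrank ℤ L

namespace SimplicialMultiFan

variable {L : Type*} [AddCommGroup L] {V : Type*} (Δ : SimplicialMultiFan L V)

/-- `Σ⁽ⁿ⁾`, the simplices with `n = rank L` vertices. -/
def facets : Finset (Finset V) :=
  Δ.faces.filter fun I => I.card = Module.finrank ℤ L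

/-- `w(I) = w⁺(I) - w⁻(I)`. -/
def weight (I : Finset V) : ℤ := (Δ.wPos I : ℤ) - (Δ.wNeg I : ℤ)

/-- The edge vector `v_i` viewed in `L_ℝ = ℝ ⊗ L`. -/
def realEdge (i : V) : ℝ ⊗[ℤ] L := (1 : ℝ) ⊗ₜ[ℤ] Δ.edge i

/-- The cone `C(I)` in `L_ℝ`, generated by the `v_i`, `i ∈ I`. -/
def cone (I : Finset V) : PointedCone ℝ (ℝ ⊗[ℤ] L) :=
  PointedCone.hull ℝ (Δ.realEdge '' (I : Set V))

/-- The linear subspace `(L_K)_ℝ` of `L_ℝ` generated by `C(K)`. -/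
def coneSpan (K : Finset V) : Submodule ℝ (ℝ ⊗[ℤ] L) :=
  Submodule.span ℝ (Δ.cone K : Set (ℝ ⊗[ℤ] L))

/-- The ambient space `L^K_ℝ = L_ℝ / (L_K)_ℝ` of the projected multi-fan `Δ_K`. -/
abbrev ProjSpace (K : Finset V) : Type _ := (ℝ ⊗[ℤ] L) ⧸ Δ.coneSpan K

/-- The cone `C_K(J)` of the projected multi-fan `Δ_K`: the image of `C(J)` in `L^K_ℝ`. -/
def projCone (K J : Finset V) : PointedCone ℝ (Δ.ProjSpace K) :=
  PointedCone.map (Δ.coneSpan K).mkQ (Δ.cone J)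

/-- `x ∈ L^K_ℝ` is generic for `Δ_K`: it lies on no linear subspace spanned by a cone `C_K(J)`,
`K ⊆ J ∈ Σ`, of dimension `|J| - |K|` less than `n - |K|`. -/
def IsGeneric (K : Finset V) (x : Δ.ProjSpace K) : Prop :=
  ∀ J ∈ Δ.faces, K ⊆ J → J.card < Module.finrank ℤ L →
    x ∉ Submodule.span ℝ (Δ.projCone K J : Set (Δ.ProjSpace K))

open Classical in
/-- The number `d_x` of the projected multi-fan `Δ_K`: the sum of `w(I)` over all `I ∈ Σ⁽ⁿ⁾`
containing `K` with `x ∈ C_K(I)`. -/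
def degreeAt (K : Finset V) (x : Δ.ProjSpace K) : ℤ :=
  ∑ I ∈ Δ.facets.filter (fun I => K ⊆ I ∧ x ∈ Δ.projCone K I), Δ.weight I

/-- The projected multi-fan `Δ_K` is pre-complete (for `K = ∅`: `Δ` is pre-complete). -/
def IsPreCompleteAt (K : Finset V) : Prop :=
  ∀ x y : Δ.ProjSpace K, Δ.IsGeneric K x → Δ.IsGeneric K y → Δ.degreeAt K x = Δ.degreeAt K y

/-- `Δ` is complete: every projected multi-fan `Δ_K`, `K ∈ Σ`, is pre-complete. -/
def IsComplete : Prop := ∀ K ∈ Δ.faces, Δ.IsPreCompleteAt K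

/-- `Δ` is non-singular: `{v_i | i ∈ I}` is a basis of the lattice `L` for all `I ∈ Σ⁽ⁿ⁾`
(linear independence being part of the structure). -/
def IsNonSingular : Prop :=
  ∀ I ∈ Δ.facets, Submodule.span ℤ (Set.range fun i : I => Δ.edge i) = ⊤

/-! ### Equivariant cohomology and the first Chern class -/

/-- The ideal generated by the monomials `∏_{i ∈ J} x_i` with `J ∉ Σ`. -/
def faceIdeal : Ideal (MvPolynomial V ℤ) :=
  Ideal.span {p | ∃ J : Finset V, J ∉ Δ.faces ∧ p = ∏ i ∈ J, MvPolynomial.X i}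

/-- `H_T^*(Δ)`, the face ring of `Σ` over `ℤ`. -/
abbrev EqCohomology : Type _ := MvPolynomial V ℤ ⧸ Δ.faceIdeal

/-- `H_T^2(Δ)`, the image of the linear forms in the `x_i`. -/
def eqCohomologyTwo : Submodule ℤ Δ.EqCohomology :=
  (MvPolynomial.homogeneousSubmodule V ℤ 1).map (Ideal.Quotient.mkₐ ℤ Δ.faceIdeal).toLinearMap

/-- The class of `x_i` in `H_T^2(Δ)`. -/
def xClass (i : V) : Δ.eqCohomologyTwo :=
  ⟨Ideal.Quotient.mkₐ ℤ Δ.faceIdeal (MvPolynomial.X i),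
    Submodule.mem_map_of_mem (MvPolynomial.isHomogeneous_X ℤ i)⟩

section ChernClass

variable [Fintype V]

/-- The map `H²(BT) = L^* → H_T^2(Δ)`, `u ↦ ∑_i ⟨u, v_i⟩ x_i`. -/
def ofDual : Module.Dual ℤ L →ₗ[ℤ] Δ.eqCohomologyTwo :=
  ∑ i, (Module.Dual.eval ℤ L (Δ.edge i)).smulRight (Δ.xClass i)

/-- The equivariant first Chern class `c_1^T(Δ) = ∑_i x_i`. -/
def eqChernClass : Δ.eqCohomologyTwo := ∑ i, Δ.xClass i

/-- The first Chern class `c_1(Δ)`: the image of `c_1^T(Δ)` in `H_T^2(Δ) / H²(BT)`. -/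
def chernClass : Δ.eqCohomologyTwo ⧸ LinearMap.range Δ.ofDual :=
  (LinearMap.range Δ.ofDual).mkQ Δ.eqChernClass

/-- `c_1(Δ)` is divisible by `N`. -/
def ChernClassDivisibleBy (N : ℕ) : Prop :=
  ∃ x : Δ.eqCohomologyTwo ⧸ LinearMap.range Δ.ofDual, Δ.chernClass = N • x

end ChernClass

/-! ### The `T_y`-genus -/

/-- For a non-singular `Δ` and `I ∈ Σ⁽ⁿ⁾`, the basis `{v_i}_{i ∈ I}` of `L`. -/
def facetBasis (h : Δ.IsNonSingular) (I : Δ.facets) : Module.Basis I.1 ℤ L :=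
  Module.Basis.mk (Δ.edge_linearIndependent I.1 (Finset.mem_of_mem_filter I.1 I.2))
    (h I.1 I.2).ge

/-- The dual basis element `u_i^I ∈ L^*`. -/
def dualVector (h : Δ.IsNonSingular) (I : Δ.facets) (i : I.1) : Module.Dual ℤ L :=
  (Δ.facetBasis h I).coord i

instance : TwoUniqueSums (Module.Dual ℤ L) :=
  TwoUniqueSums.of_injective_addHom
    (⟨fun u x => u x, fun _ _ => rfl⟩ : AddHom (Module.Dual ℤ L) (L → ℤ))
    (fun _ _ h => LinearMap.ext (congrFun h)) inferInstance

instance : IsDomain (AddMonoidAlgebra ℤ (Module.Dual ℤ L)) :=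
  NoZeroDivisors.to_isDomain _

variable (L) in
/-- The character ring `R(T) = ℤ[L^*]`, with basis the `t^u`, `u ∈ L^*`. -/
abbrev CharRing : Type _ := AddMonoidAlgebra ℤ (Module.Dual ℤ L)

variable (L) in
/-- The fraction field of `R(T)`. -/
abbrev CharField : Type _ := FractionRing (CharRing L)

/-- The element `t^u` of (the fraction field of) `R(T)`. -/
def tPow (u : Module.Dual ℤ L) : CharField L :=
  algebraMap (CharRing L) (CharField L) (AddMonoidAlgebra.single u 1)

/-- The equivariant `T_y`-genus of a non-singular multi-fan,
`∑_{I ∈ Σ⁽ⁿ⁾} w(I) ∏_{i ∈ I} (1 + y t^{-u_i^I}) / (1 - t^{-u_i^I})`,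
a polynomial in the variable `y` over the fraction field of `R(T)`. -/
def eqTyGenus (h : Δ.IsNonSingular) : (CharField L)[X] :=
  ∑ I : Δ.facets, C (Δ.weight I.1 : CharField L) *
    ∏ i : I.1, C ((1 - tPow (-Δ.dualVector h I i))⁻¹) * (1 + C (tPow (-Δ.dualVector h I i)) * X)

/-- `P ∈ ℤ[y]` is the constant value of the equivariant `T_y`-genus. -/
def IsTyGenus (h : Δ.IsNonSingular) (P : ℤ[X]) : Prop :=
  P.map (algebraMap ℤ (CharField L)) = Δ.eqTyGenus h

open Classical in
/-- The `T_y`-genus `T_y[Δ] ∈ ℤ[y]`: the constant value of the equivariant `T_y`-genus (and `0` if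
that is not constant). -/
def tyGenus (h : Δ.IsNonSingular) : ℤ[X] :=
  if hP : ∃ P, Δ.IsTyGenus h P then hP.choose else 0

/-- The Todd genus `T_0[Δ]`, the value of `T_y[Δ]` at `y = 0`. -/
def toddGenus (h : Δ.IsNonSingular) : ℤ := (Δ.tyGenus h).eval 0

end SimplicialMultiFan

end

open scoped TensorProduct
open Polynomial

noncomputable section

namespace SimplicialMultiFan

variable {L : Type*} [AddCommGroup L] {V : Type*} (Δ : SimplicialMultiFan L V)

/-! ### Coordinates with respect to the facets -/

/-! Everything rests on one invariance principle, `sum_prod_eq_of_isGenericVector`. Take a weighted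
sum over facets of products whose factors change with the sign of `⟨u_i^I, v⟩`. Expanding each
product over subsets `K` of `I` and regrouping by `K` turns the sign conditions into membership in
the cones `C_K(I)`. Completeness then makes the sum independent of the generic `v`.

First use: expand each local contribution to the genus as a formal series, in the direction
prescribed by a generic `v`. The coefficient of `t^(-a)` in the total does not depend on `v`. For `a
≠ 0`, choosing `v` with `⟨a, v⟩ < 0` makes it vanish, so the genus is the constant `∑ w(I) (-y)^#{i
| ⟨u_i^I, v⟩ < 0}` (`isTyGenus_combGenus`).

Second use: divisibility of `c_1` by `N` yields `u ∈ L^*` with `⟨u, v_i⟩ ≡ 1` mod `N` for all `i`.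
For `z^N = 1` and generic `l` with `⟨u, l⟩ ≡ 1`, the step function `F(s) = ∑ w(I) z^(-∑ ⌊s ⟨u_i^I,
l⟩⌋)` has equal one-sided limits everywhere (`eventually_floorSum_eq`), so it takes a single value
near all points. Near `0` that value is `T_{-z}`, while `z F(s + 1) = F(s)`; hence `(1 - z) T_{-z} =
0`. With `z` the universal `N`-th root of unity, `1 + X + ⋯ + X^(N-1)` divides `T_{-X}`.

Finally `v ↦ -v` gives `T_{-X}` equal extreme coefficients `T_0 ≠ 0` in degrees `0` and `n`. So the
quotient has degree `n + 1 - N` and both its extreme coefficients are `T_0`; this bounds `N` and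
determines the quotient when it has degree `0` or `1`. -/

lemma mem_facets {I : Finset V} :
    I ∈ Δ.facets ↔ I ∈ Δ.faces ∧ I.card = Module.finrank ℤ L := Finset.mem_filter

open Classical in
/-- The dual vector `u_i^I`, extended by `0` to the vertices outside `I`. -/
def coord (h : Δ.IsNonSingular) (I : Δ.facets) (i : V) : Module.Dual ℤ L :=
  if hi : i ∈ I.1 then Δ.dualVector h I ⟨i, hi⟩ else 0

variable {Δ} in
lemma coord_coe (h : Δ.IsNonSingular) (I : Δ.facets) (i : I.1) :
    Δ.coord h I i = Δ.dualVector h I i := by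
  simp [coord]

open Classical in
lemma coord_edge (h : Δ.IsNonSingular) (I : Δ.facets) {i j : V} (hi : i ∈ I.1) (hj : j ∈ I.1) :
    Δ.coord h I i (Δ.edge j) = if i = j then 1 else 0 := by
  have hb : Δ.edge j = Δ.facetBasis h I ⟨j, hj⟩ := by simp [facetBasis]
  rw [coord, dif_pos hi, dualVector, hb, Module.Basis.coord_apply, Module.Basis.repr_self,
    Finsupp.single_apply]
  simp [eq_comm]

lemma sum_coord_smul_edge (h : Δ.IsNonSingular) (I : Δ.facets) (x : L) :
    ∑ i ∈ I.1, Δ.coord h I i x • Δ.edge i = x := by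
  rw [← Finset.sum_coe_sort]
  conv_rhs => rw [← (Δ.facetBasis h I).sum_repr x]
  refine Finset.sum_congr rfl fun i _ => ?_
  rw [coord_coe]
  simp [dualVector, facetBasis]

lemma dual_apply_eq_sum (h : Δ.IsNonSingular) (I : Δ.facets) (a : Module.Dual ℤ L) (x : L) :
    a x = ∑ i ∈ I.1, Δ.coord h I i x * a (Δ.edge i) := by
  conv_lhs => rw [← Δ.sum_coord_smul_edge h I x]
  simp

/-- The real-linear extension of an integral functional. -/
def realDual (a : Module.Dual ℤ L) : (ℝ ⊗[ℤ] L) →ₗ[ℝ] ℝ := Module.Dual.baseChange ℝ a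

lemma realDual_tmul (a : Module.Dual ℤ L) (r : ℝ) (x : L) :
    realDual a (r ⊗ₜ[ℤ] x) = (a x : ℝ) * r := by
  simp [realDual, Module.Dual.baseChange]

lemma realDual_realEdge (a : Module.Dual ℤ L) (i : V) :
    realDual a (Δ.realEdge i) = a (Δ.edge i) := by
  simp [realEdge, realDual_tmul]

lemma one_tmul_eq_sum (h : Δ.IsNonSingular) (I : Δ.facets) (x : L) :
    (1 : ℝ) ⊗ₜ[ℤ] x = ∑ i ∈ I.1, (Δ.coord h I i x : ℝ) • Δ.realEdge i := by
  conv_lhs => rw [← Δ.sum_coord_smul_edge h I x]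
  rw [TensorProduct.tmul_sum]
  refine Finset.sum_congr rfl fun i _ => ?_
  rw [TensorProduct.tmul_smul, realEdge, Int.cast_smul_eq_zsmul]

/-! ### Cones and generic vectors -/

lemma cone_le_span (K : Finset V) :
    (Δ.cone K : Set (ℝ ⊗[ℤ] L)) ⊆ Submodule.span ℝ (Δ.realEdge '' (K : Set V)) := by
  intro x hx
  refine Submodule.span_induction (p := fun x _ => x ∈ Submodule.span ℝ (Δ.realEdge '' (K : Set V)))
    (fun y hy => Submodule.subset_span hy) (Submodule.zero_mem _)
    (fun _ _ _ _ => Submodule.add_mem _) (fun c y _ hy => ?_) hx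
  exact Submodule.smul_mem _ (c : ℝ) hy

lemma coneSpan_eq (K : Finset V) :
    Δ.coneSpan K = Submodule.span ℝ (Δ.realEdge '' (K : Set V)) :=
  le_antisymm (Submodule.span_le.2 (Δ.cone_le_span K))
    (Submodule.span_mono PointedCone.subset_hull)

lemma realDual_eq_zero_of_mem_span {K : Finset V} {a : Module.Dual ℤ L}
    (ha : ∀ j ∈ K, a (Δ.edge j) = 0) {x : ℝ ⊗[ℤ] L}
    (hx : x ∈ Submodule.span ℝ (Δ.realEdge '' (K : Set V))) : realDual a x = 0 := by
  have : Submodule.span ℝ (Δ.realEdge '' (K : Set V)) ≤ LinearMap.ker (realDual a) := by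
    rw [Submodule.span_le]
    rintro _ ⟨j, hj, rfl⟩
    simp [realDual_realEdge, ha j hj]
  exact this hx

lemma realDual_nonneg_of_mem_cone {I : Finset V} {a : Module.Dual ℤ L}
    (ha : ∀ j ∈ I, 0 ≤ a (Δ.edge j)) {x : ℝ ⊗[ℤ] L} (hx : x ∈ Δ.cone I) : 0 ≤ realDual a x := by
  refine Submodule.span_induction (p := fun x _ => 0 ≤ realDual a x) ?_ (by simp) ?_ ?_ hx
  · rintro _ ⟨j, hj, rfl⟩
    rw [realDual_realEdge]
    exact_mod_cast ha j hj
  · intro x y _ _ hx hy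
    rw [map_add]
    exact add_nonneg hx hy
  · intro c x _ hx
    have : realDual a (c • x) = (c : ℝ) * realDual a x := by
      rw [← smul_eq_mul, ← map_smul]; rfl
    rw [this]
    exact mul_nonneg c.2 hx

/-- The functionals `u_i^I` with `i ∉ K` vanish on the span of `C(K)`, so they survive in the
quotient; conversely, dropping the `K`-terms of a vector does not change its class. -/
lemma mkQ_mem_projCone_iff (h : Δ.IsNonSingular) (I : Δ.facets) {K : Finset V} (hK : K ⊆ I.1)
    (v : L) : (Δ.coneSpan K).mkQ ((1 : ℝ) ⊗ₜ[ℤ] v) ∈ Δ.projCone K I.1 ↔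
      ∀ i ∈ I.1, i ∉ K → 0 ≤ Δ.coord h I i v := by
  classical
  rw [projCone, PointedCone.mem_map]
  constructor
  · rintro ⟨c, hc, hcv⟩ i hi hiK
    have h1 : c - (1 : ℝ) ⊗ₜ[ℤ] v ∈ Δ.coneSpan K := by
      rw [← Submodule.Quotient.eq]
      exact hcv
    rw [coneSpan_eq] at h1
    have h2 := Δ.realDual_eq_zero_of_mem_span (a := Δ.coord h I i) (fun j hj => by
      rw [Δ.coord_edge h I hi (hK hj), if_neg]
      rintro rfl
      exact hiK hj) h1
    have h3 := Δ.realDual_nonneg_of_mem_cone (a := Δ.coord h I i) (fun j hj => by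
      rw [Δ.coord_edge h I hi hj]
      split_ifs <;> simp) hc
    rw [map_sub, realDual_tmul, sub_eq_zero] at h2
    rw [h2, mul_one] at h3
    exact_mod_cast h3
  · intro hv
    refine ⟨∑ i ∈ I.1 \ K, (Δ.coord h I i v : ℝ) • Δ.realEdge i, ?_, ?_⟩
    · refine Submodule.sum_mem _ fun i hi => ?_
      rw [Finset.mem_sdiff] at hi
      have h0 : (0 : ℝ) ≤ (Δ.coord h I i v : ℝ) := by exact_mod_cast hv i hi.1 hi.2
      exact Submodule.smul_mem _ (⟨_, h0⟩ : {c : ℝ // 0 ≤ c})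
        (PointedCone.subset_hull ⟨i, hi.1, rfl⟩)
    · rw [Δ.one_tmul_eq_sum h I v, ← Finset.sum_sdiff hK, map_add, left_eq_add]
      rw [Submodule.mkQ_apply, Submodule.Quotient.mk_eq_zero, coneSpan_eq]
      exact Submodule.sum_mem _ fun i hi =>
        Submodule.smul_mem _ _ (Submodule.subset_span ⟨i, hi, rfl⟩)

/-- A lattice vector lying on no linear subspace spanned by the edges of a simplex with fewer than
`rank L` vertices. -/
def IsGenericVector (v : L) : Prop :=
  ∀ J ∈ Δ.faces, J.card < Module.finrank ℤ L →
    (1 : ℝ) ⊗ₜ[ℤ] v ∉ Submodule.span ℝ (Δ.realEdge '' (J : Set V))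

variable {Δ}

lemma IsGenericVector.neg {v : L} (hv : Δ.IsGenericVector v) : Δ.IsGenericVector (-v) := by
  intro J hJ hJc hmem
  rw [TensorProduct.tmul_neg, Submodule.neg_mem_iff] at hmem
  exact hv J hJ hJc hmem

lemma IsGenericVector.isGeneric {v : L} (hv : Δ.IsGenericVector v) (K : Finset V) :
    Δ.IsGeneric K ((Δ.coneSpan K).mkQ ((1 : ℝ) ⊗ₜ[ℤ] v)) := by
  intro J hJ hKJ hJc hmem
  have h1 : Submodule.span ℝ (Δ.projCone K J : Set (Δ.ProjSpace K)) ≤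
      (Submodule.span ℝ (Δ.realEdge '' (J : Set V))).map (Δ.coneSpan K).mkQ := by
    rw [Submodule.span_le]
    rintro x hx
    obtain ⟨c, hc, rfl⟩ := PointedCone.mem_map.1 hx
    exact Submodule.mem_map_of_mem (Δ.cone_le_span J hc)
  obtain ⟨c, hc, hcv⟩ := h1 hmem
  have h2 : c - (1 : ℝ) ⊗ₜ[ℤ] v ∈ Δ.coneSpan K := by
    rw [← Submodule.Quotient.eq]
    exact hcv
  rw [coneSpan_eq] at h2
  have h3 := Submodule.sub_mem _ hc
    (Submodule.span_mono (Set.image_mono (Finset.coe_subset.2 hKJ)) h2)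
  rw [sub_sub_cancel] at h3
  exact hv J hJ hJc h3

lemma IsGenericVector.coord_ne_zero {v : L} (hv : Δ.IsGenericVector v) (h : Δ.IsNonSingular)
    (I : Δ.facets) {i : V} (hi : i ∈ I.1) : Δ.coord h I i v ≠ 0 := by
  classical
  intro h0
  have hI := Δ.mem_facets.1 I.2
  refine hv (I.1.erase i) (Δ.down_closed _ hI.1 _ (Finset.erase_subset _ _)) ?_ ?_
  · rw [← hI.2]
    exact Finset.card_erase_lt_of_mem hi
  · rw [Δ.one_tmul_eq_sum h I v, ← Finset.add_sum_erase _ _ hi, h0, Int.cast_zero, zero_smul,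
      zero_add]
    exact Submodule.sum_mem _ fun j hj =>
      Submodule.smul_mem _ _ (Submodule.subset_span ⟨j, hj, rfl⟩)

/-- Finitely many nonzero functionals are simultaneously nonzero somewhere on any coset `x + N L`
with `N ≠ 0`. -/
lemma exists_forall_dual_ne_zero [Module.Free ℤ L] [Module.Finite ℤ L]
    (S : Finset (Module.Dual ℤ L)) (hS : (0 : Module.Dual ℤ L) ∉ S) (x : L) {N : ℤ} (hN : N ≠ 0) :
    ∃ z : L, ∀ a ∈ S, a (x + N • z) ≠ 0 := by
  classical
  let r := Module.finrank ℤ L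
  let b : Module.Basis (Fin r) ℤ L := Module.finBasis ℤ L
  -- `p a` evaluated at `m` is `a` on the point `x + N ∑ m^(k+1) b_k` of a moment curve. Exponents
  -- start at `1` so that `a x` cannot cancel the coefficients that detect `a`.
  let p : Module.Dual ℤ L → ℤ[X] := fun a => C (a x) + ∑ k : Fin r, C (N * a (b k)) * X ^ (k.1 + 1)
  have hp : ∀ a ∈ S, p a ≠ 0 := by
    intro a ha h0
    refine hS ?_
    convert ha
    symm
    refine b.ext fun k => ?_
    have h1 := congrArg (fun q => q.coeff (k.1 + 1)) h0
    simp only [p, coeff_add, coeff_C_succ, finsetSum_coeff, coeff_C_mul, coeff_X_pow,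
      coeff_zero, zero_add] at h1
    rw [Finset.sum_eq_single k] at h1
    · simpa [hN] using h1
    · intro j _ hj
      rw [if_neg, mul_zero]
      intro h2
      exact hj (Fin.ext (by omega))
    · simp
  have hprod : ∏ a ∈ S, p a ≠ 0 := Finset.prod_ne_zero_iff.2 hp
  obtain ⟨m, hm⟩ : ∃ m : ℤ, (∏ a ∈ S, p a).eval m ≠ 0 := by
    by_contra! hcon
    exact hprod (Polynomial.funext fun m => by simpa using hcon m)
  refine ⟨∑ k : Fin r, m ^ (k.1 + 1) • b k, fun a ha h0 => hm ?_⟩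
  rw [eval_prod]
  refine Finset.prod_eq_zero ha ?_
  rw [← h0]
  simp only [p, eval_add, eval_C, eval_finsetSum, eval_mul, eval_pow, eval_X, map_add, map_smul,
    map_sum, smul_eq_mul, Finset.mul_sum]
  congr 1
  exact Finset.sum_congr rfl fun k _ => by ring

lemma exists_dual_ne_zero_of_card_lt [Module.Free ℤ L] [Module.Finite ℤ L] (J : Finset V)
    (hJ : J.card < Module.finrank ℤ L) :
    ∃ a : Module.Dual ℤ L, a ≠ 0 ∧ ∀ j ∈ J, a (Δ.edge j) = 0 := by
  let f : Module.Dual ℤ L →ₗ[ℤ] (J → ℤ) :=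
    LinearMap.pi fun j => Module.Dual.eval ℤ L (Δ.edge j)
  have hf : ¬ Function.Injective f := by
    intro hinj
    have h1 := LinearMap.finrank_le_finrank_of_injective hinj
    rw [Module.finrank_fintype_fun_eq_card, Fintype.card_coe] at h1
    have h2 : Module.finrank ℤ (Module.Dual ℤ L) = Module.finrank ℤ L :=
      (Module.finrank_linearMap ℤ ℤ L ℤ).trans (by rw [Module.finrank_self, mul_one])
    omega
  rw [← LinearMap.ker_eq_bot, Submodule.eq_bot_iff] at hf
  push Not at hf
  obtain ⟨a, ha, ha0⟩ := hf
  refine ⟨a, ha0, fun j hj => ?_⟩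
  exact congrFun (LinearMap.mem_ker.1 ha) ⟨j, hj⟩

variable (Δ) in
lemma exists_isGenericVector [Module.Free ℤ L] [Module.Finite ℤ L] {a : Module.Dual ℤ L}
    (ha : a ≠ 0) (x : L) {N : ℤ} (hN : N ≠ 0) :
    ∃ z : L, Δ.IsGenericVector (x + N • z) ∧ a (x + N • z) ≠ 0 := by
  classical
  have key : ∀ J : Finset V, ∃ b : Module.Dual ℤ L, b ≠ 0 ∧
      (J.card < Module.finrank ℤ L → ∀ j ∈ J, b (Δ.edge j) = 0) := by
    intro J
    by_cases hJ : J.card < Module.finrank ℤ L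
    · obtain ⟨b, hb, hb'⟩ := exists_dual_ne_zero_of_card_lt (Δ := Δ) J hJ
      exact ⟨b, hb, fun _ => hb'⟩
    · exact ⟨a, ha, fun h => absurd h hJ⟩
  choose b hb0 hb using key
  obtain ⟨z, hz⟩ := exists_forall_dual_ne_zero (insert a (Δ.faces.image b))
    (by simp [ha.symm, hb0]) x hN
  refine ⟨z, fun J hJ hJc hmem => ?_, hz a (by simp)⟩
  have h1 := Δ.realDual_eq_zero_of_mem_span (hb J hJc) hmem
  rw [realDual_tmul, mul_one] at h1
  exact hz (b J) (Finset.mem_insert_of_mem (Finset.mem_image_of_mem b hJ)) (by exact_mod_cast h1)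

/-! ### Sums over the facets that do not depend on the generic vector -/

open Classical in
lemma IsGenericVector.degreeAt_eq {v : L} (hv : Δ.IsGenericVector v) (h : Δ.IsNonSingular)
    (K : Finset V) :
    Δ.degreeAt K ((Δ.coneSpan K).mkQ ((1 : ℝ) ⊗ₜ[ℤ] v)) = ∑ I : Δ.facets,
      if K ⊆ I.1 ∧ ∀ i ∈ I.1, i ∉ K → 0 < Δ.coord h I i v then Δ.weight I.1 else 0 := by
  rw [degreeAt, Finset.sum_filter, ← Finset.sum_coe_sort]
  refine Finset.sum_congr rfl fun I _ => if_congr ?_ rfl rfl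
  refine and_congr_right fun hK => ?_
  rw [Δ.mkQ_mem_projCone_iff h I hK]
  exact forall₃_congr fun i hi _ => ⟨fun h0 => h0.lt_of_ne' (hv.coord_ne_zero h I hi), le_of_lt⟩

-- Interchange of summation: for fixed `K`, the facets containing `K` whose coordinates outside `K`
-- are positive are exactly those counted by the degree of `Δ_K`.
open Classical in
lemma sum_powerset_eq_sum_degreeAt {R : Type*} [CommRing R] (h : Δ.IsNonSingular)
    (A : Δ.facets → Finset V → R) (B : Finset V → R)
    (hB : ∀ (I : Δ.facets) (K : Finset V), K ⊆ I.1 → A I K = B K)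
    {v : L} (hv : Δ.IsGenericVector v) :
    ∑ I : Δ.facets, (Δ.weight I.1 : R) * ∑ K ∈ I.1.powerset,
      A I K * (if ∀ i ∈ I.1, i ∉ K → 0 < Δ.coord h I i v then 1 else 0) =
    ∑ K ∈ Δ.faces, B K * (Δ.degreeAt K ((Δ.coneSpan K).mkQ ((1 : ℝ) ⊗ₜ[ℤ] v)) : R) := by
  have h1 : ∀ I : Δ.facets, (Δ.weight I.1 : R) * ∑ K ∈ I.1.powerset,
      A I K * (if ∀ i ∈ I.1, i ∉ K → 0 < Δ.coord h I i v then 1 else 0) =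
      ∑ K ∈ Δ.faces, B K *
        if K ⊆ I.1 ∧ ∀ i ∈ I.1, i ∉ K → 0 < Δ.coord h I i v then (Δ.weight I.1 : R) else 0 := by
    intro I
    have hsub : I.1.powerset ⊆ Δ.faces := fun K hK =>
      Δ.down_closed _ (Δ.mem_facets.1 I.2).1 _ (Finset.mem_powerset.1 hK)
    rw [Finset.mul_sum]
    refine (Finset.sum_congr rfl fun K hK => ?_).trans (Finset.sum_subset hsub fun K _ hK => ?_)
    · rw [Finset.mem_powerset] at hK
      rw [hB I K hK]
      simp only [hK, true_and]
      split_ifs <;> ring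
    · rw [Finset.mem_powerset] at hK
      rw [if_neg (fun hc => hK hc.1), mul_zero]
  rw [Finset.sum_congr rfl fun I _ => h1 I, Finset.sum_comm]
  refine Finset.sum_congr rfl fun K _ => ?_
  rw [← Finset.mul_sum, hv.degreeAt_eq h K]
  push_cast
  rfl

open Classical in
/-- The basic invariance principle: a weighted sum over the facets of products of factors
depending only on the sign of the coordinates does not depend on the generic vector. -/
lemma sum_prod_eq_of_isGenericVector {R : Type*} [CommRing R] (h : Δ.IsNonSingular)
    (hc : Δ.IsComplete) (f g : Δ.facets → V → R)
    (hfg : ∀ (I I' : Δ.facets) (K : Finset V), K ⊆ I.1 → K ⊆ I'.1 →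
      (∏ i ∈ K, f I i) * ∏ i ∈ I.1 \ K, g I i = (∏ i ∈ K, f I' i) * ∏ i ∈ I'.1 \ K, g I' i)
    {v v' : L} (hv : Δ.IsGenericVector v) (hv' : Δ.IsGenericVector v') :
    ∑ I : Δ.facets, (Δ.weight I.1 : R) *
      ∏ i ∈ I.1, (f I i + if 0 < Δ.coord h I i v then g I i else 0) =
    ∑ I : Δ.facets, (Δ.weight I.1 : R) *
      ∏ i ∈ I.1, (f I i + if 0 < Δ.coord h I i v' then g I i else 0) := by
  let A : Δ.facets → Finset V → R := fun I K => (∏ i ∈ K, f I i) * ∏ i ∈ I.1 \ K, g I i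
  -- By `hfg` the choice of facet is immaterial; simplices lying in no facet get the value `0`.
  let B : Finset V → R := fun K => if hK : ∃ I : Δ.facets, K ⊆ I.1 then A hK.choose K else 0
  have hB : ∀ (I : Δ.facets) (K : Finset V), K ⊆ I.1 → A I K = B K := by
    intro I K hK
    have hex : ∃ I : Δ.facets, K ⊆ I.1 := ⟨I, hK⟩
    simp only [B, dif_pos hex]
    exact hfg _ _ _ hK hex.choose_spec
  have key : ∀ w : L, ∑ I : Δ.facets, (Δ.weight I.1 : R) *
      ∏ i ∈ I.1, (f I i + if 0 < Δ.coord h I i w then g I i else 0) =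
      ∑ I : Δ.facets, (Δ.weight I.1 : R) * ∑ K ∈ I.1.powerset,
        A I K * (if ∀ i ∈ I.1, i ∉ K → 0 < Δ.coord h I i w then 1 else 0) := by
    intro w
    refine Finset.sum_congr rfl fun I _ => ?_
    congr 1
    rw [Finset.prod_add]
    refine Finset.sum_congr rfl fun K _ => ?_
    rw [mul_assoc]
    congr 1
    have : ∀ i ∈ I.1 \ K, (if 0 < Δ.coord h I i w then g I i else 0) =
        g I i * if 0 < Δ.coord h I i w then 1 else 0 := fun i _ => by split_ifs <;> simp
    rw [Finset.prod_congr rfl this, Finset.prod_mul_distrib, Finset.prod_boole]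
    simp only [Finset.mem_sdiff, and_imp]
  rw [key, key, sum_powerset_eq_sum_degreeAt h A B hB hv,
    sum_powerset_eq_sum_degreeAt h A B hB hv']
  refine Finset.sum_congr rfl fun K hK => ?_
  rw [hc K hK _ _ (hv.isGeneric K) (hv'.isGeneric K)]

/-! ### The formal expansion of the equivariant genus -/

/-- The coefficient of `t ^ (-m)` in the expansion of `(1 + y t⁻¹) / (1 - t⁻¹)` in powers of
`t⁻¹` (for `pos`) or of `t` (otherwise). -/
def expansionCoeff (pos : Prop) [Decidable pos] (m : ℤ) : ℤ[X] :=
  (if m < 0 then -(1 + X) else if m = 0 then -X else 0) + if pos then 1 + X else 0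

/-- Both expansions, multiplied by `1 - t⁻¹`, give `1 + y t⁻¹`; this is that identity
coefficientwise. -/
lemma expansionCoeff_sub (pos : Prop) [Decidable pos] (m : ℤ) :
    expansionCoeff pos m - expansionCoeff pos (m - 1) =
      (if m = 0 then 1 else 0) + X * if m - 1 = 0 then 1 else 0 := by
  rcases lt_trichotomy m 0 with hm | rfl | hm
  · simp [expansionCoeff, hm, hm.ne, show m - 1 < 0 by omega, show m - 1 ≠ 0 by omega]
  · simp [expansionCoeff]
  · rcases (show m = 1 ∨ 1 < m by omega) with rfl | hm1
    · simp [expansionCoeff]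
    · simp [expansionCoeff, hm.ne', show ¬ m < 0 by omega, show ¬ m - 1 < 0 by omega,
        show m - 1 ≠ 0 by omega]

lemma nonneg_mul_of_expansionCoeff_ne_zero {x m : ℤ} (hx : x ≠ 0)
    (hm : expansionCoeff (0 < x) m ≠ 0) : 0 ≤ x * m := by
  rcases hx.lt_or_gt with h0 | h0
  · refine mul_nonneg_of_nonpos_of_nonpos h0.le ?_
    by_contra! hcon
    refine hm ?_
    simp [expansionCoeff, h0.not_gt, hcon.not_gt, hcon.ne']
  · refine mul_nonneg h0.le ?_
    by_contra! hcon
    refine hm ?_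
    simp [expansionCoeff, h0, hcon]

open Classical in
/-- The combinatorial `T_y`-genus `∑_I w(I) (-y) ^ #{i ∈ I | ⟨u_i^I, v⟩ < 0}`. -/
def combGenus (h : Δ.IsNonSingular) (v : L) : ℤ[X] :=
  ∑ I : Δ.facets, (Δ.weight I.1 : ℤ[X]) *
    (-X) ^ (I.1.filter fun i => Δ.coord h I i v < 0).card

/-- The coefficient of `t ^ (-a)` in the expansion of the equivariant genus in the direction
`v`. -/
def genusCoeff (h : Δ.IsNonSingular) (v : L) (a : Module.Dual ℤ L) : ℤ[X] :=
  ∑ I : Δ.facets, (Δ.weight I.1 : ℤ[X]) *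
    ∏ i ∈ I.1, expansionCoeff (0 < Δ.coord h I i v) (a (Δ.edge i))

/-- The part of each factor that does not see `v` depends only on the edge vector, and the jump is
always `1 + y`. So the `K`-term involves only `K` and `n - |K|`, not the facet. -/
lemma genusCoeff_eq_of_isGenericVector (h : Δ.IsNonSingular) (hc : Δ.IsComplete) {v v' : L}
    (hv : Δ.IsGenericVector v) (hv' : Δ.IsGenericVector v') (a : Module.Dual ℤ L) :
    genusCoeff h v a = genusCoeff h v' a := by
  classical
  have := sum_prod_eq_of_isGenericVector h hc (R := ℤ[X])
    (fun _ i => if a (Δ.edge i) < 0 then -(1 + X) else if a (Δ.edge i) = 0 then -X else 0)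
    (fun _ _ => 1 + X) (fun I I' K hK hK' => by
      rw [Finset.prod_const, Finset.prod_const, Finset.card_sdiff_of_subset hK,
        Finset.card_sdiff_of_subset hK', (Δ.mem_facets.1 I.2).2, (Δ.mem_facets.1 I'.2).2]) hv hv'
  simpa only [genusCoeff, expansionCoeff] using this

lemma genusCoeff_zero (h : Δ.IsNonSingular) {v : L} (hv : Δ.IsGenericVector v) :
    genusCoeff h v 0 = combGenus h v := by
  classical
  refine Finset.sum_congr rfl fun I _ => ?_
  congr 1
  rw [← Finset.prod_const, Finset.prod_filter]
  refine Finset.prod_congr rfl fun i hi => ?_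
  rcases (hv.coord_ne_zero h I hi).lt_or_gt with h0 | h0
  · simp [expansionCoeff, h0, h0.not_gt]
  · simp [expansionCoeff, h0, h0.not_gt]

lemma combGenus_eq_of_isGenericVector (h : Δ.IsNonSingular) (hc : Δ.IsComplete) {v v' : L}
    (hv : Δ.IsGenericVector v) (hv' : Δ.IsGenericVector v') :
    combGenus h v = combGenus h v' := by
  rw [← genusCoeff_zero h hv, ← genusCoeff_zero h hv',
    genusCoeff_eq_of_isGenericVector h hc hv hv']

/-- Move to a generic `w` with `⟨a, w⟩ < 0`. A nonzero product would force every term of `⟨a, w⟩ = ∑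
⟨u_i^I, w⟩ ⟨a, v_i⟩` to be nonnegative. -/
lemma genusCoeff_eq_zero [Module.Free ℤ L] [Module.Finite ℤ L] (h : Δ.IsNonSingular)
    (hc : Δ.IsComplete) {v : L} (hv : Δ.IsGenericVector v) {a : Module.Dual ℤ L} (ha : a ≠ 0) :
    genusCoeff h v a = 0 := by
  obtain ⟨w, hw, haw⟩ : ∃ w : L, Δ.IsGenericVector w ∧ a w < 0 := by
    obtain ⟨z, hz, haz⟩ := Δ.exists_isGenericVector ha 0 one_ne_zero
    rcases haz.lt_or_gt with h0 | h0
    · exact ⟨_, hz, h0⟩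
    · exact ⟨_, hz.neg, by rw [map_neg]; omega⟩
  rw [genusCoeff_eq_of_isGenericVector h hc hv hw]
  refine Finset.sum_eq_zero fun I _ => ?_
  by_contra hne
  have h1 := right_ne_zero_of_mul hne
  rw [Finset.prod_ne_zero_iff] at h1
  refine haw.not_ge ?_
  rw [Δ.dual_apply_eq_sum h I a w]
  exact Finset.sum_nonneg fun i hi =>
    nonneg_mul_of_expansionCoeff_ne_zero (hw.coord_ne_zero h I hi) (h1 i hi)

/-! ### Constancy of the equivariant genus -/

variable (L) in
/-- The group ring `ℤ[y][L^*]`. -/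
abbrev PolyCharRing : Type _ := AddMonoidAlgebra ℤ[X] (Module.Dual ℤ L)

/-- The `ℤ[y]`-linear functional on `ℤ[y][L^*]` with prescribed values on the characters. -/
def pairing (c : Module.Dual ℤ L → ℤ[X]) : PolyCharRing L →ₗ[ℤ[X]] ℤ[X] :=
  (Finsupp.linearCombination ℤ[X] c).comp
    (AddMonoidAlgebra.coeffLinearEquiv ℤ[X]).toLinearMap

lemma pairing_single (c : Module.Dual ℤ L → ℤ[X]) (a : Module.Dual ℤ L) (r : ℤ[X]) :
    pairing c (AddMonoidAlgebra.single a r) = r * c a := by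
  exact Finsupp.linearCombination_single ℤ[X] r a

/-- `pairing c f` is the constant term of `f · ∑ c(a) t^(-a)`. Series in different directions cannot
be multiplied together, but each can be multiplied by a Laurent polynomial. The hypothesis says `(1
- t^(-u)) c = (1 + y t^(-u)) c'` as series. -/
lemma pairing_one_sub_mul {c c' : Module.Dual ℤ L → ℤ[X]} {u : Module.Dual ℤ L}
    (hcc : ∀ a, c a - c (a - u) = c' a + X * c' (a - u)) (f : PolyCharRing L) :
    pairing c ((1 - AddMonoidAlgebra.single (-u) 1) * f) =
      pairing c' ((1 + AddMonoidAlgebra.single (-u) X) * f) := by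
  induction f using AddMonoidAlgebra.induction_linear with
  | zero => simp
  | add f g hf hg => rw [mul_add, mul_add, map_add, map_add, hf, hg]
  | single a r =>
    rw [sub_mul, add_mul, one_mul, AddMonoidAlgebra.single_mul_single,
      AddMonoidAlgebra.single_mul_single, map_sub, map_add, pairing_single, pairing_single,
      pairing_single, pairing_single, neg_add_eq_sub, one_mul]
    linear_combination r * hcc a

open Classical in
/-- The coefficients of the expansion of the product over `S ⊆ I` of the factors of the
contribution of the facet `I`. -/
def partialCoeff (h : Δ.IsNonSingular) (v : L) (I : Δ.facets) (S : Finset V)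
    (a : Module.Dual ℤ L) : ℤ[X] :=
  ∏ i ∈ I.1, if i ∈ S then expansionCoeff (0 < Δ.coord h I i v) (a (Δ.edge i))
    else if a (Δ.edge i) = 0 then 1 else 0

-- Subtracting `u_i^I` lowers the `i`-th coordinate of `a` by one and fixes the others in `I`, so
-- the identity reduces to the one-variable recurrence.
open Classical in
lemma partialCoeff_insert_sub (h : Δ.IsNonSingular) (v : L) (I : Δ.facets)
    {S : Finset V} {i : V} (hi : i ∈ I.1) (hS : i ∉ S) (a : Module.Dual ℤ L) :
    partialCoeff h v I (insert i S) a - partialCoeff h v I (insert i S) (a - Δ.coord h I i) =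
      partialCoeff h v I S a + X * partialCoeff h v I S (a - Δ.coord h I i) := by
  have hne : ∀ j ∈ I.1.erase i, (a - Δ.coord h I i) (Δ.edge j) = a (Δ.edge j) := by
    intro j hj
    rw [Finset.mem_erase] at hj
    rw [LinearMap.sub_apply, Δ.coord_edge h I hi hj.2, if_neg (Ne.symm hj.1), sub_zero]
  have heq : (a - Δ.coord h I i) (Δ.edge i) = a (Δ.edge i) - 1 := by
    rw [LinearMap.sub_apply, Δ.coord_edge h I hi hi, if_pos rfl]
  simp only [partialCoeff]
  rw [← Finset.mul_prod_erase _ _ hi, ← Finset.mul_prod_erase _ _ hi,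
    ← Finset.mul_prod_erase _ _ hi, ← Finset.mul_prod_erase _ _ hi]
  have h1 : ∀ b : Module.Dual ℤ L, (∀ j ∈ I.1.erase i, b (Δ.edge j) = a (Δ.edge j)) →
      ∀ T : Finset V, (T = S ∨ T = insert i S) →
      (∏ j ∈ I.1.erase i, if j ∈ T then expansionCoeff (0 < Δ.coord h I j v) (b (Δ.edge j))
        else if b (Δ.edge j) = 0 then 1 else 0) =
      ∏ j ∈ I.1.erase i, if j ∈ S then expansionCoeff (0 < Δ.coord h I j v) (a (Δ.edge j))
        else if a (Δ.edge j) = 0 then 1 else 0 := by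
    intro b hb T hT
    refine Finset.prod_congr rfl fun j hj => ?_
    have hj' : j ∈ T ↔ j ∈ S := by
      rcases hT with rfl | rfl
      · rfl
      · simp [(Finset.mem_erase.1 hj).1]
    rw [hb j hj]
    simp only [hj']
  rw [h1 a (fun _ _ => rfl) _ (Or.inr rfl), h1 a (fun _ _ => rfl) _ (Or.inl rfl),
    h1 _ hne _ (Or.inr rfl), h1 _ hne _ (Or.inl rfl), heq]
  simp only [Finset.mem_insert, true_or, if_true, hS, if_false]
  linear_combination (∏ j ∈ I.1.erase i,
    if j ∈ S then expansionCoeff (0 < Δ.coord h I j v) (a (Δ.edge j))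
      else if a (Δ.edge j) = 0 then 1 else 0) *
    expansionCoeff_sub (0 < Δ.coord h I i v) (a (Δ.edge i))

lemma pairing_partialCoeff (h : Δ.IsNonSingular) (v : L) (I : Δ.facets) {S : Finset V}
    (hS : S ⊆ I.1) (f : PolyCharRing L) :
    pairing (partialCoeff h v I S)
      ((∏ i ∈ S, (1 - AddMonoidAlgebra.single (-Δ.coord h I i) (1 : ℤ[X]))) * f) =
    pairing (partialCoeff h v I ∅)
      ((∏ i ∈ S, (1 + AddMonoidAlgebra.single (-Δ.coord h I i) (X : ℤ[X]))) * f) := by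
  classical
  induction S using Finset.induction_on generalizing f with
  | empty => simp
  | insert i S hi ih =>
    rw [Finset.prod_insert hi, Finset.prod_insert hi, mul_assoc,
      pairing_one_sub_mul (partialCoeff_insert_sub h v I (hS (Finset.mem_insert_self i S)) hi),
      mul_left_comm, ih ((Finset.subset_insert i S).trans hS), mul_left_comm, mul_assoc]

lemma partialCoeff_empty [DecidableEq (Module.Dual ℤ L)] (h : Δ.IsNonSingular) (v : L)
    (I : Δ.facets) : partialCoeff h v I ∅ = Pi.single 0 1 := by
  classical
  funext a
  simp only [partialCoeff, Finset.notMem_empty, if_false, Finset.prod_boole]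
  rw [Pi.single_apply]
  refine if_congr ⟨fun h0 => LinearMap.ext fun x => ?_, ?_⟩ rfl rfl
  · rw [Δ.dual_apply_eq_sum h I a x]
    exact Finset.sum_eq_zero fun i hi => by rw [h0 i hi, mul_zero]
  · rintro rfl
    simp

lemma sum_weight_partialCoeff [Module.Free ℤ L] [Module.Finite ℤ L]
    [DecidableEq (Module.Dual ℤ L)] (h : Δ.IsNonSingular)
    (hc : Δ.IsComplete) {v : L} (hv : Δ.IsGenericVector v) (f : PolyCharRing L) :
    ∑ I : Δ.facets, (Δ.weight I.1 : ℤ[X]) * pairing (partialCoeff h v I I.1) f =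
      combGenus h v * pairing (Pi.single 0 1) f := by
  classical
  induction f using AddMonoidAlgebra.induction_linear with
  | zero => simp
  | add f g hf hg => simp only [map_add, mul_add, Finset.sum_add_distrib, hf, hg]
  | single a r =>
    have h1 : ∑ I : Δ.facets, (Δ.weight I.1 : ℤ[X]) * partialCoeff h v I I.1 a =
        genusCoeff h v a := by
      refine Finset.sum_congr rfl fun I _ => ?_
      congr 1
      exact Finset.prod_congr rfl fun i hi => by rw [if_pos hi]
    have h2 : genusCoeff h v a = combGenus h v * (Pi.single 0 1 : Module.Dual ℤ L → ℤ[X]) a := by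
      by_cases ha : a = 0
      · rw [ha, genusCoeff_zero h hv, Pi.single_eq_same, mul_one]
      · rw [genusCoeff_eq_zero h hc hv ha, Pi.single_eq_of_ne ha, mul_zero]
    simp only [pairing_single]
    calc _ = r * ∑ I : Δ.facets, (Δ.weight I.1 : ℤ[X]) * partialCoeff h v I I.1 a := by
          rw [Finset.mul_sum]
          exact Finset.sum_congr rfl fun I _ => by ring
      _ = _ := by rw [h1, h2]; ring

lemma eq_of_pairing_eq [DecidableEq (Module.Dual ℤ L)] {f g : PolyCharRing L}
    (hfg : ∀ a : Module.Dual ℤ L, pairing (Pi.single 0 1) (f * AddMonoidAlgebra.single a 1) =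
      pairing (Pi.single 0 1) (g * AddMonoidAlgebra.single a 1)) : f = g := by
  have key : ∀ (f : PolyCharRing L) (a : Module.Dual ℤ L),
      pairing (Pi.single 0 1) (f * AddMonoidAlgebra.single (-a) 1) = f.coeff a := by
    intro f a
    induction f using AddMonoidAlgebra.induction_linear with
    | zero => simp
    | add f g hf hg => rw [add_mul, map_add, hf, hg]; simp
    | single b r =>
      rw [AddMonoidAlgebra.single_mul_single, pairing_single, AddMonoidAlgebra.coeff_single,
        Finsupp.single_apply, Pi.single_apply, ← sub_eq_add_neg]
      simp [sub_eq_zero]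
  apply AddMonoidAlgebra.coeff_injective
  ext1 a
  rw [← key, ← key, hfg]

open Classical in
/-- The localization formula for the genus with denominators cleared. -/
lemma denominators_mul_combGenus [Module.Free ℤ L] [Module.Finite ℤ L] (h : Δ.IsNonSingular)
    (hc : Δ.IsComplete) {v : L} (hv : Δ.IsGenericVector v) :
    (∏ I : Δ.facets, ∏ i ∈ I.1, (1 - AddMonoidAlgebra.single (-Δ.coord h I i) (1 : ℤ[X]))) *
      AddMonoidAlgebra.single 0 (combGenus h v) =
    ∑ I : Δ.facets, (Δ.weight I.1 : PolyCharRing L) *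
      ((∏ J ∈ Finset.univ.erase I, ∏ i ∈ J.1,
          (1 - AddMonoidAlgebra.single (-Δ.coord h J i) (1 : ℤ[X]))) *
        ∏ i ∈ I.1, (1 + AddMonoidAlgebra.single (-Δ.coord h I i) (X : ℤ[X]))) := by
  -- Compare constant terms after multiplication by every `t^a`; this recovers all coefficients.
  refine eq_of_pairing_eq fun a => ?_
  set D : PolyCharRing L :=
    ∏ I : Δ.facets, ∏ i ∈ I.1, (1 - AddMonoidAlgebra.single (-Δ.coord h I i) (1 : ℤ[X])) with hD
  have h1 : D * AddMonoidAlgebra.single 0 (combGenus h v) * AddMonoidAlgebra.single a 1 =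
      combGenus h v • (D * AddMonoidAlgebra.single a 1) := by
    rw [mul_assoc, AddMonoidAlgebra.single_mul_single, ← mul_smul_comm,
      AddMonoidAlgebra.smul_single]
    simp
  rw [h1, map_smul, smul_eq_mul, ← sum_weight_partialCoeff h hc hv, Finset.sum_mul, map_sum]
  refine Finset.sum_congr rfl fun I _ => ?_
  rw [← zsmul_eq_mul, ← zsmul_eq_mul, smul_mul_assoc, map_zsmul, ← partialCoeff_empty h v I,
    mul_comm (∏ J ∈ Finset.univ.erase I, _), mul_assoc,
    ← pairing_partialCoeff h v I subset_rfl, ← mul_assoc,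
    Finset.mul_prod_erase Finset.univ
      (fun J : Δ.facets => ∏ i ∈ J.1, (1 - AddMonoidAlgebra.single (-Δ.coord h J i) (1 : ℤ[X])))
      (Finset.mem_univ I)]

/-! ### Passage to the fraction field of the character ring -/

lemma intCast_charField_injective :
    Function.Injective (algebraMap ℤ (CharField L)) := by
  have h1 : algebraMap ℤ (CharField L) =
      (algebraMap (CharRing L) (CharField L)).comp (algebraMap ℤ (CharRing L)) :=
    RingHom.ext_int _ _
  rw [h1]
  exact (IsFractionRing.injective (CharRing L) (CharField L)).comp
    (FaithfulSMul.algebraMap_injective ℤ (CharRing L))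

lemma tPow_zero : tPow (0 : Module.Dual ℤ L) = 1 := map_one _

lemma tPow_add (a b : Module.Dual ℤ L) : tPow (a + b) = tPow a * tPow b := by
  rw [tPow, tPow, tPow, ← map_mul, AddMonoidAlgebra.single_mul_single, one_mul]

lemma one_sub_tPow_ne_zero {a : Module.Dual ℤ L} (ha : a ≠ 0) : 1 - tPow a ≠ 0 := by
  rw [sub_ne_zero, ← tPow_zero]
  intro h0
  have h1 := IsFractionRing.injective (CharRing L) (CharField L) h0
  have h2 := congrArg (fun f => f.coeff 0) h1
  simp [ha] at h2

variable (L) in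
/-- The ring homomorphism `ℤ[y][L^*] → K[y]`, where `K` is the fraction field of `ℤ[L^*]`. -/
def polyCharHom : PolyCharRing L →+* (CharField L)[X] :=
  AddMonoidAlgebra.liftNCRingHom (mapRingHom (algebraMap ℤ (CharField L)))
    { toFun := fun a => C (tPow a.toAdd)
      map_one' := by rw [toAdd_one, tPow_zero, C_1]
      map_mul' := fun a b => by rw [toAdd_mul, tPow_add, C_mul] }
    (fun _ _ => Commute.all _ _)

lemma polyCharHom_single (a : Module.Dual ℤ L) (r : ℤ[X]) :
    polyCharHom L (AddMonoidAlgebra.single a r) =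
      r.map (algebraMap ℤ (CharField L)) * C (tPow a) :=
  AddMonoidAlgebra.liftNC_single _ _ a r

lemma coord_ne_zero (h : Δ.IsNonSingular) (I : Δ.facets) {i : V} (hi : i ∈ I.1) :
    Δ.coord h I i ≠ 0 := by
  classical
  intro h0
  have := Δ.coord_edge h I hi hi
  simp [h0] at this

lemma eqTyGenus_eq (h : Δ.IsNonSingular) :
    Δ.eqTyGenus h = ∑ I : Δ.facets, C (Δ.weight I.1 : CharField L) *
      ∏ i ∈ I.1, C ((1 - tPow (-Δ.coord h I i))⁻¹) * (1 + C (tPow (-Δ.coord h I i)) * X) := by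
  simp only [eqTyGenus, ← coord_coe]
  refine Finset.sum_congr rfl fun I _ => congrArg _ ?_
  exact Finset.prod_coe_sort I.1 fun i => C ((1 - tPow (-Δ.coord h I i))⁻¹) *
    (1 + C (tPow (-Δ.coord h I i)) * X)

theorem isTyGenus_combGenus [Module.Free ℤ L] [Module.Finite ℤ L] (h : Δ.IsNonSingular)
    (hc : Δ.IsComplete) {v : L} (hv : Δ.IsGenericVector v) : Δ.IsTyGenus h (combGenus h v) := by
  classical
  have h1 := congrArg (polyCharHom L) (denominators_mul_combGenus h hc hv)
  simp only [map_mul, map_prod, map_sum, map_sub, map_add, map_one, map_intCast,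
    polyCharHom_single, Polynomial.map_one, one_mul, tPow_zero, mul_one, map_X] at h1
  have hD : ∏ I : Δ.facets, ∏ i ∈ I.1, (1 - C (tPow (-Δ.coord h I i))) ≠ 0 := by
    refine Finset.prod_ne_zero_iff.2 fun I _ => Finset.prod_ne_zero_iff.2 fun i hi => ?_
    rw [← C_1, ← C_sub]
    exact C_ne_zero.2 (one_sub_tPow_ne_zero (neg_ne_zero.2 (coord_ne_zero h I hi)))
  refine mul_left_cancel₀ hD (h1.trans ?_)
  rw [eqTyGenus_eq, Finset.mul_sum]
  refine Finset.sum_congr rfl fun I _ => ?_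
  rw [← Finset.mul_prod_erase Finset.univ
      (fun J : Δ.facets => ∏ i ∈ J.1, (1 - C (tPow (-Δ.coord h J i)))) (Finset.mem_univ I)]
  have h2 : (∏ i ∈ I.1, (1 - C (tPow (-Δ.coord h I i)))) * (∏ i ∈ I.1,
      C ((1 - tPow (-Δ.coord h I i))⁻¹) * (1 + C (tPow (-Δ.coord h I i)) * X)) =
      ∏ i ∈ I.1, (1 + X * C (tPow (-Δ.coord h I i))) := by
    rw [← Finset.prod_mul_distrib]
    refine Finset.prod_congr rfl fun i hi => ?_
    rw [← mul_assoc, ← C_1, ← C_sub, ← C_mul,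
      mul_inv_cancel₀ (one_sub_tPow_ne_zero (neg_ne_zero.2 (coord_ne_zero h I hi))), C_1, one_mul,
      mul_comm]
  rw [← h2, map_intCast]
  ring

lemma IsTyGenus.unique {h : Δ.IsNonSingular} {P Q : ℤ[X]} (hP : Δ.IsTyGenus h P)
    (hQ : Δ.IsTyGenus h Q) : P = Q :=
  map_injective _ intCast_charField_injective (hP.trans hQ.symm)

lemma IsTyGenus.tyGenus_eq {h : Δ.IsNonSingular} {P : ℤ[X]} (hP : Δ.IsTyGenus h P) :
    Δ.tyGenus h = P := by
  have hex : ∃ P, Δ.IsTyGenus h P := ⟨P, hP⟩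
  rw [tyGenus, dif_pos hex]
  exact hex.choose_spec.unique hP

/-! ### Divisibility of the first Chern class -/

open Classical in
variable (Δ) in
/-- The ring homomorphism `H_T^*(Δ) → ℤ[X]` restricting to the vertex `i`. -/
def restrictVertex (i : V) : Δ.EqCohomology →+* ℤ[X] :=
  Ideal.Quotient.lift Δ.faceIdeal
    (MvPolynomial.aeval (R := ℤ) fun j : V => if j = i then (X : ℤ[X]) else 0).toRingHom <| by
    intro p hp
    refine Submodule.span_induction (p := fun p _ =>
      (MvPolynomial.aeval (R := ℤ) fun j : V => if j = i then (X : ℤ[X]) else 0).toRingHom p = 0)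
      ?_ (map_zero _) (fun x y _ _ hx hy => by rw [map_add, hx, hy, add_zero])
      (fun a x _ hx => by rw [smul_eq_mul, map_mul, hx, mul_zero]) hp
    rintro _ ⟨J, hJ, rfl⟩
    obtain ⟨j, hj, hji⟩ : ∃ j ∈ J, j ≠ i := by
      by_contra! hcon
      exact hJ (Δ.down_closed {i} (Δ.singleton_mem i) J fun j hj =>
        Finset.mem_singleton.2 (hcon j hj))
    rw [map_prod]
    exact Finset.prod_eq_zero hj (by simp [hji])

open Classical in
lemma restrictVertex_xClass (i j : V) :
    Δ.restrictVertex i (Δ.xClass j : Δ.EqCohomology) = if j = i then X else 0 := by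
  change (MvPolynomial.aeval (R := ℤ) fun j : V => if j = i then (X : ℤ[X]) else 0)
    (MvPolynomial.X j) = _
  rw [MvPolynomial.aeval_X]

variable (Δ) in
/-- The coefficient of `x_i` of a class in `H_T^2(Δ)`. -/
def xCoeff (i : V) : Δ.eqCohomologyTwo →ₗ[ℤ] ℤ :=
  (lcoeff ℤ 1).comp ((Δ.restrictVertex i).toIntAlgHom.toLinearMap.comp
    Δ.eqCohomologyTwo.subtype)

open Classical in
lemma xCoeff_xClass (i j : V) : Δ.xCoeff i (Δ.xClass j) = if j = i then 1 else 0 := by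
  change (Δ.restrictVertex i (Δ.xClass j : Δ.EqCohomology)).coeff 1 = _
  rw [restrictVertex_xClass]
  split_ifs <;> simp

/-- Lift the divisibility to `c_1^T - N y = ∑ ⟨u, v_i⟩ x_i` in `H_T^2(Δ)` and compare coefficients
of each `x_i`. -/
lemma ChernClassDivisibleBy.exists_dual [Fintype V] {N : ℕ} (hN : Δ.ChernClassDivisibleBy N) :
    ∃ u : Module.Dual ℤ L, ∀ i : V, u (Δ.edge i) ≡ 1 [ZMOD N] := by
  classical
  obtain ⟨x, hx⟩ := hN
  obtain ⟨y, rfl⟩ := Submodule.mkQ_surjective _ x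
  rw [chernClass, ← map_nsmul, Submodule.mkQ_apply, Submodule.mkQ_apply,
    Submodule.Quotient.eq] at hx
  obtain ⟨u, hu⟩ := hx
  refine ⟨u, fun i => ?_⟩
  have h1 := congrArg (Δ.xCoeff i) hu
  simp only [ofDual, eqChernClass, LinearMap.sum_apply, LinearMap.smulRight_apply, map_sum,
    map_smul, xCoeff_xClass, map_sub, map_nsmul, Module.Dual.eval_apply, smul_eq_mul, mul_ite,
    mul_one, mul_zero, Finset.sum_ite_eq', Finset.mem_univ, if_true] at h1
  rw [h1, Int.modEq_iff_dvd]
  exact ⟨Δ.xCoeff i y, by simp⟩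

/-! ### Vanishing at roots of unity -/

open Filter Topology

lemma zpow_eq_zpow_of_modEq {G : Type*} [Group G] {z : G} {N : ℕ} (hz : z ^ N = 1) {a b : ℤ}
    (hab : a ≡ b [ZMOD N]) : z ^ a = z ^ b := by
  obtain ⟨c, hc⟩ := Int.modEq_iff_dvd.1 hab
  rw [show b = a + N * c by omega, zpow_add, zpow_mul, zpow_natCast, hz, one_zpow, mul_one]

lemma prod_units_zpow {R ι : Type*} [CommRing R] (z : Rˣ) (S : Finset ι) (e : ι → ℤ) :
    ∏ i ∈ S, (↑(z ^ e i) : R) = ↑(z ^ ∑ i ∈ S, e i) := by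
  rw [← Units.coe_prod]
  congr 1
  exact (map_sum (zpowersHom Rˣ z).toAdditiveRight _ _).symm

lemma sum_coord_modEq (h : Δ.IsNonSingular) {N : ℕ} {u : Module.Dual ℤ L}
    (hu : ∀ i : V, u (Δ.edge i) ≡ 1 [ZMOD N]) (I : Δ.facets) (x : L) :
    ∑ i ∈ I.1, Δ.coord h I i x ≡ u x [ZMOD N] := by
  rw [Δ.dual_apply_eq_sum h I u x]
  refine Int.ModEq.sum fun i _ => ?_
  simpa using ((hu i).symm.mul_left (Δ.coord h I i x))

lemma eventually_floor_mul_right (s a : ℝ) (ha : a ≠ 0) :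
    ∀ᶠ t in 𝓝[>] s, ⌊t * a⌋ = if 0 < a then ⌊s * a⌋ else ⌈s * a⌉ - 1 := by
  have hcont : Tendsto (fun t : ℝ => t * a) (𝓝[>] s) (𝓝 (s * a)) :=
    ((continuous_mul_const a).tendsto s).mono_left nhdsWithin_le_nhds
  split_ifs with h0
  · have h1 : Tendsto (fun t : ℝ => t * a) (𝓝[>] s) (𝓝[≥] (s * a)) :=
      tendsto_nhdsWithin_iff.2 ⟨hcont, eventually_mem_nhdsWithin.mono fun t ht =>
        mul_le_mul_of_nonneg_right (le_of_lt ht) h0.le⟩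
    exact tendsto_pure.1 ((tendsto_floor_right_pure_floor (s * a)).comp h1)
  · have h1 : Tendsto (fun t : ℝ => t * a) (𝓝[>] s) (𝓝[<] (s * a)) :=
      tendsto_nhdsWithin_iff.2 ⟨hcont, eventually_mem_nhdsWithin.mono fun t ht =>
        mul_lt_mul_of_neg_right ht (lt_of_le_of_ne (not_lt.1 h0) ha)⟩
    exact tendsto_pure.1 ((tendsto_floor_left_pure_ceil_sub_one (s * a)).comp h1)

lemma eventually_floor_mul_left (s a : ℝ) (ha : a ≠ 0) :
    ∀ᶠ t in 𝓝[<] s, ⌊t * a⌋ = if 0 < -a then ⌊s * a⌋ else ⌈s * a⌉ - 1 := by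
  have h1 := eventually_floor_mul_right (-s) (-a) (neg_ne_zero.2 ha)
  have h2 : Tendsto (fun t : ℝ => -t) (𝓝[<] s) (𝓝[>] (-s)) := tendsto_neg_nhdsLT
  filter_upwards [h2.eventually h1] with t ht
  simpa using ht

/-- A function on `ℝ` that is constant on a punctured neighbourhood of every point takes the same
value near all points. -/
lemma exists_forall_eventually_eq {α : Type*} {F : ℝ → α}
    (hF : ∀ s, ∃ c, ∀ᶠ t in 𝓝[≠] s, F t = c) : ∃ c, ∀ s, ∀ᶠ t in 𝓝[≠] s, F t = c := by
  choose G hG using hF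
  have hloc : IsLocallyConstant G := by
    rw [IsLocallyConstant.iff_eventually_eq]
    intro s
    rw [← nhdsNE_sup_pure s, eventually_sup]
    refine ⟨?_, rfl⟩
    -- For `y ≠ s` near `s`, `F` equals `G s` on a full neighbourhood of `y` and `G y` on a
    -- punctured one, so the two agree.
    filter_upwards [eventually_eventually_nhdsWithin.2 (hG s), eventually_mem_nhdsWithin]
      with y hy hys
    rw [isOpen_compl_singleton.nhdsWithin_eq hys] at hy
    obtain ⟨t, ht1, ht2⟩ := ((hG y).and (hy.filter_mono nhdsWithin_le_nhds)).exists
    exact ht1.symm.trans ht2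
  refine ⟨G 0, fun s => ?_⟩
  rw [hloc.apply_eq_of_isPreconnected isPreconnected_univ (Set.mem_univ 0) (Set.mem_univ s)]
  exact hG s

/-- The sum `∑_I w(I) ζ ^ (-∑_{i ∈ I} ⌊s ⟨u_i^I, l⟩⌋)`. -/
def floorSum {R : Type*} [CommRing R] (h : Δ.IsNonSingular) (z : Rˣ) (l : L) (s : ℝ) : R :=
  ∑ I : Δ.facets, (Δ.weight I.1 : R) * ∏ i ∈ I.1, (↑(z ^ (-⌊s * Δ.coord h I i l⌋)) : R)

lemma floorSum_eq {R : Type*} [CommRing R] (h : Δ.IsNonSingular) (z : Rˣ) (l : L) (s : ℝ) :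
    floorSum h z l s = ∑ I : Δ.facets,
      (Δ.weight I.1 : R) * (↑(z ^ (-∑ i ∈ I.1, ⌊s * Δ.coord h I i l⌋)) : R) := by
  refine Finset.sum_congr rfl fun I _ => ?_
  rw [prod_units_zpow, Finset.sum_neg_distrib]

lemma floorSum_add_one {R : Type*} [CommRing R] (h : Δ.IsNonSingular) {z : Rˣ} {N : ℕ}
    (hz : z ^ N = 1) {u : Module.Dual ℤ L} (hu : ∀ i : V, u (Δ.edge i) ≡ 1 [ZMOD N]) {l : L}
    (hl : u l ≡ 1 [ZMOD N]) (s : ℝ) :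
    z * floorSum h z l (s + 1) = floorSum h z l s := by
  rw [floorSum_eq, floorSum_eq, Finset.mul_sum]
  refine Finset.sum_congr rfl fun I _ => ?_
  rw [mul_left_comm, ← Units.val_mul, ← zpow_one_add]
  congr 2
  refine zpow_eq_zpow_of_modEq hz ?_
  have h1 : ∑ i ∈ I.1, ⌊(s + 1) * Δ.coord h I i l⌋ =
      ∑ i ∈ I.1, ⌊s * Δ.coord h I i l⌋ + ∑ i ∈ I.1, Δ.coord h I i l := by
    rw [← Finset.sum_add_distrib]
    refine Finset.sum_congr rfl fun i _ => ?_
    rw [add_mul, one_mul, Int.floor_add_intCast]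
  rw [h1]
  have h2 := ((sum_coord_modEq h hu I l).trans hl).symm
  rw [Int.modEq_iff_dvd] at h2 ⊢
  convert h2 using 1
  ring

-- If `s l` has integral `I`-coordinates outside `K`, it is a real combination of the edges of `K`
-- plus a lattice vector. The first part has the same coordinates in every facet containing `K`, the
-- second integral ones.
open Classical in
lemma mul_coord_eq (h : Δ.IsNonSingular) {I J : Δ.facets} {K : Finset V} (hKI : K ⊆ I.1)
    (hKJ : K ⊆ J.1) {s : ℝ} {l : L}
    (hcrit : ∀ i ∈ I.1 \ K, (⌈s * Δ.coord h I i l⌉ : ℝ) = s * Δ.coord h I i l) {i : V}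
    (hi : i ∈ J.1) :
    s * Δ.coord h J i l = (if i ∈ K then s * Δ.coord h I i l else 0) +
      (Δ.coord h J i (∑ j ∈ I.1 \ K, ⌈s * Δ.coord h I j l⌉ • Δ.edge j) : ℤ) := by
  rw [Δ.dual_apply_eq_sum h I (Δ.coord h J i) l, ← Finset.sum_sdiff hKI, add_comm, Int.cast_add,
    mul_add]
  congr 1
  · have h1 : ∀ j ∈ K, Δ.coord h I j l * Δ.coord h J i (Δ.edge j) =
        if i = j then Δ.coord h I j l else 0 := fun j hj => by
      rw [Δ.coord_edge h J hi (hKJ hj)]; simp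
    rw [Finset.sum_congr rfl h1, Finset.sum_ite_eq]
    split_ifs <;> simp
  · rw [map_sum, Int.cast_sum, Int.cast_sum, Finset.mul_sum]
    refine Finset.sum_congr rfl fun j hj => ?_
    rw [map_smul, smul_eq_mul, Int.cast_mul, Int.cast_mul, hcrit j hj, mul_assoc]

lemma ceil_sub_floor_cases (x : ℝ) : (⌈x⌉ : ℝ) = x ∧ ⌊x⌋ = ⌈x⌉ ∨ (⌈x⌉ : ℝ) ≠ x ∧ ⌊x⌋ = ⌈x⌉ - 1 := by
  by_cases hx : (⌈x⌉ : ℝ) = x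
  · refine Or.inl ⟨hx, ?_⟩
    conv_lhs => rw [← hx]
    exact Int.floor_intCast _
  · refine Or.inr ⟨hx, Int.floor_eq_iff.2 ⟨?_, ?_⟩⟩
    · push_cast
      linarith [Int.ceil_lt_add_one x]
    · push_cast
      rw [sub_add_cancel]
      exact lt_of_le_of_ne (Int.le_ceil x) (Ne.symm hx)

/-- The jump of `ζ ^ (-⌊x⌋)` at a point `x`. -/
def floorJump {R : Type*} [CommRing R] (z : Rˣ) (x : ℝ) : R :=
  ↑(z ^ (-⌊x⌋)) - ↑(z ^ (-(⌈x⌉ - 1)))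

lemma floorJump_of_ceil_ne {R : Type*} [CommRing R] (z : Rˣ) {x : ℝ} (hx : (⌈x⌉ : ℝ) ≠ x) :
    floorJump z x = (0 : R) := by
  rcases ceil_sub_floor_cases x with h1 | h1
  · exact absurd h1.1 hx
  · rw [floorJump, h1.2, sub_self]

lemma floorJump_of_ceil_eq {R : Type*} [CommRing R] (z : Rˣ) {x : ℝ} (hx : (⌈x⌉ : ℝ) = x) :
    floorJump z x = (↑(z ^ (-⌈x⌉)) : R) * (1 - z) := by
  rcases ceil_sub_floor_cases x with h1 | h1
  · rw [floorJump, h1.2, neg_sub, sub_eq_add_neg 1, add_comm 1, zpow_add_one, Units.val_mul]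
    ring
  · exact absurd hx h1.1

lemma ceil_eq_of_subset (h : Δ.IsNonSingular) {I J : Δ.facets} {K : Finset V} (hKI : K ⊆ I.1)
    (hKJ : K ⊆ J.1) {s : ℝ} {l : L} [DecidableEq V]
    (hcrit : ∀ i ∈ I.1 \ K, (⌈s * Δ.coord h I i l⌉ : ℝ) = s * Δ.coord h I i l) :
    ∀ i ∈ J.1 \ K, (⌈s * Δ.coord h J i l⌉ : ℝ) = s * Δ.coord h J i l := by
  classical
  intro i hi
  rw [Finset.mem_sdiff] at hi
  rw [mul_coord_eq h hKI hKJ (fun j hj => hcrit j (by convert hj)) hi.1, if_neg hi.2, zero_add,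
    Int.ceil_intCast]

/-- By the splitting in `mul_coord_eq`, each side is the sum of the ceilings over `K` plus the
coordinate sum of one lattice vector `x`, which is `⟨u, x⟩` mod `N` in any facet. -/
lemma sum_ceil_modEq (h : Δ.IsNonSingular) {N : ℕ} {u : Module.Dual ℤ L}
    (hu : ∀ i : V, u (Δ.edge i) ≡ 1 [ZMOD N]) {I J : Δ.facets} {K : Finset V} (hKI : K ⊆ I.1)
    (hKJ : K ⊆ J.1) {s : ℝ} {l : L} [DecidableEq V]
    (hcrit : ∀ i ∈ I.1 \ K, (⌈s * Δ.coord h I i l⌉ : ℝ) = s * Δ.coord h I i l) :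
    ∑ i ∈ I.1, ⌈s * Δ.coord h I i l⌉ ≡ ∑ i ∈ J.1, ⌈s * Δ.coord h J i l⌉ [ZMOD N] := by
  classical
  set x := ∑ j ∈ I.1 \ K, ⌈s * Δ.coord h I j l⌉ • Δ.edge j with hx
  have key : ∀ J' : Δ.facets, K ⊆ J'.1 → ∑ i ∈ J'.1, ⌈s * Δ.coord h J' i l⌉ ≡
      ∑ i ∈ K, ⌈s * Δ.coord h I i l⌉ + u x [ZMOD N] := by
    intro J' hJ'
    have h1 : ∀ i ∈ J'.1, ⌈s * Δ.coord h J' i l⌉ =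
        (if i ∈ K then ⌈s * Δ.coord h I i l⌉ else 0) + Δ.coord h J' i x := by
      intro i hi
      rw [mul_coord_eq h hKI hJ' (fun j hj => hcrit j (by convert hj)) hi, Int.ceil_add_intCast]
      congr 1
      · split_ifs <;> simp
      · rw [hx]; congr!
    rw [Finset.sum_congr rfl h1, Finset.sum_add_distrib, Finset.sum_ite_mem,
      Finset.inter_eq_right.2 hJ']
    exact (sum_coord_modEq h hu J' x).add_left _
  exact (key I hKI).trans (key J hKJ).symm

lemma prod_mul_prod_floorJump {R : Type*} [CommRing R] (h : Δ.IsNonSingular) (z : Rˣ)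
    {I : Δ.facets} {K : Finset V} (hKI : K ⊆ I.1) {s : ℝ} {l : L} [DecidableEq V]
    (hcrit : ∀ i ∈ I.1 \ K, (⌈s * Δ.coord h I i l⌉ : ℝ) = s * Δ.coord h I i l) :
    (∏ i ∈ K, (↑(z ^ (-(⌈s * Δ.coord h I i l⌉ - 1))) : R)) *
      ∏ i ∈ I.1 \ K, floorJump z (s * Δ.coord h I i l) =
    ↑(z ^ ((K.card : ℤ) - ∑ i ∈ I.1, ⌈s * Δ.coord h I i l⌉)) *
      (1 - (z : R)) ^ (Module.finrank ℤ L - K.card) := by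
  rw [Finset.prod_congr rfl fun i hi => floorJump_of_ceil_eq z (hcrit i hi),
    Finset.prod_mul_distrib, Finset.prod_const, Finset.card_sdiff_of_subset hKI,
    (Δ.mem_facets.1 I.2).2, ← mul_assoc, prod_units_zpow, prod_units_zpow, ← Units.val_mul,
    ← zpow_add]
  congr 3
  rw [← Finset.sum_sdiff hKI]
  simp only [Finset.sum_neg_distrib, Finset.sum_sub_distrib, Finset.sum_const, nsmul_eq_mul,
    mul_one]
  ring

/-- The one-sided limits of `floorSum` at `s` agree. -/
lemma eventually_floorSum_eq {R : Type*} [CommRing R] (h : Δ.IsNonSingular)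
    (hc : Δ.IsComplete) {z : Rˣ} {N : ℕ} (hz : z ^ N = 1) {u : Module.Dual ℤ L}
    (hu : ∀ i : V, u (Δ.edge i) ≡ 1 [ZMOD N]) {l : L} (hl : Δ.IsGenericVector l) (s : ℝ) :
    ∀ᶠ t in 𝓝[≠] s, floorSum h z l t = ∑ I : Δ.facets, (Δ.weight I.1 : R) *
      ∏ i ∈ I.1, (↑(z ^ (-(⌈s * Δ.coord h I i l⌉ - 1))) +
        if 0 < Δ.coord h I i l then floorJump z (s * Δ.coord h I i l) else 0) := by
  classical
  have hval : ∀ (I : Δ.facets) (i : V) (t : ℝ) (p : Prop) [Decidable p],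
      ⌊t * Δ.coord h I i l⌋ =
        (if p then ⌊s * Δ.coord h I i l⌋ else ⌈s * Δ.coord h I i l⌉ - 1) →
      (↑(z ^ (-⌊t * Δ.coord h I i l⌋)) : R) = ↑(z ^ (-(⌈s * Δ.coord h I i l⌉ - 1))) +
        if p then floorJump z (s * Δ.coord h I i l) else 0 := by
    intro I i t p _ ht
    rw [ht]
    split_ifs
    · rw [floorJump]; ring
    · rw [add_zero]
  have hne : ∀ (I : Δ.facets), ∀ i ∈ I.1, (Δ.coord h I i l : ℝ) ≠ 0 := fun I i hi =>
    Int.cast_ne_zero.2 (hl.coord_ne_zero h I hi)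
  rw [← nhdsLT_sup_nhdsGT, eventually_sup]
  constructor
  · have hev : ∀ᶠ t : ℝ in 𝓝[<] s, ∀ I : Δ.facets, ∀ i ∈ I.1, ⌊t * Δ.coord h I i l⌋ =
        if 0 < -(Δ.coord h I i l : ℝ) then ⌊s * Δ.coord h I i l⌋
          else ⌈s * Δ.coord h I i l⌉ - 1 :=
      eventually_all.2 fun I => (eventually_all_finset _).2 fun i hi =>
        eventually_floor_mul_left s _ (hne I i hi)
    -- The left limit is the right-limit expression with `l` replaced by `-l` in the sign test only.
    -- Each `K`-term is facet-independent: a nonintegral value outside `K` kills it, and otherwise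
    -- it depends only on `|K|` and a ceiling sum mod `N`.
    have hinv := sum_prod_eq_of_isGenericVector h hc
      (fun I i => (↑(z ^ (-(⌈s * Δ.coord h I i l⌉ - 1))) : R))
      (fun I i => floorJump z (s * Δ.coord h I i l)) (fun I J K hKI hKJ => by
        by_cases hcrit : ∀ i ∈ I.1 \ K, (⌈s * Δ.coord h I i l⌉ : ℝ) = s * Δ.coord h I i l
        · have hcrit' := ceil_eq_of_subset h hKI hKJ hcrit
          rw [prod_mul_prod_floorJump h z hKI hcrit, prod_mul_prod_floorJump h z hKJ hcrit',
            zpow_eq_zpow_of_modEq hz ((sum_ceil_modEq h hu hKI hKJ hcrit).sub_left _)]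
        · have hcrit' : ¬ ∀ i ∈ J.1 \ K, (⌈s * Δ.coord h J i l⌉ : ℝ) = s * Δ.coord h J i l :=
            fun hJ => hcrit (ceil_eq_of_subset h hKJ hKI hJ)
          push Not at hcrit hcrit'
          obtain ⟨i, hi, hi'⟩ := hcrit
          obtain ⟨j, hj, hj'⟩ := hcrit'
          rw [Finset.prod_eq_zero hi (floorJump_of_ceil_ne z hi'),
            Finset.prod_eq_zero hj (floorJump_of_ceil_ne z hj'), mul_zero, mul_zero])
      hl hl.neg
    filter_upwards [hev] with t ht
    rw [hinv]
    refine Finset.sum_congr rfl fun I _ => congrArg _ (Finset.prod_congr rfl fun i hi => ?_)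
    rw [hval I i t _ (ht I i hi)]
    refine congrArg _ (if_congr ?_ rfl rfl)
    rw [map_neg]
    exact_mod_cast Iff.rfl
  · have hev : ∀ᶠ t : ℝ in 𝓝[>] s, ∀ I : Δ.facets, ∀ i ∈ I.1, ⌊t * Δ.coord h I i l⌋ =
        if 0 < (Δ.coord h I i l : ℝ) then ⌊s * Δ.coord h I i l⌋
          else ⌈s * Δ.coord h I i l⌉ - 1 :=
      eventually_all.2 fun I => (eventually_all_finset _).2 fun i hi =>
        eventually_floor_mul_right s _ (hne I i hi)
    filter_upwards [hev] with t ht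
    refine Finset.sum_congr rfl fun I _ => congrArg _ (Finset.prod_congr rfl fun i hi => ?_)
    rw [hval I i t _ (ht I i hi)]
    exact congrArg _ (if_congr Int.cast_pos rfl rfl)

/-- At `s = 0` the limiting factor is `1` for a positive coordinate and `z` for a negative one. -/
lemma aeval_combGenus {R : Type*} [CommRing R] (h : Δ.IsNonSingular) (z : Rˣ) {l : L}
    (hl : Δ.IsGenericVector l) :
    aeval (-(z : R)) (combGenus h l) = ∑ I : Δ.facets, (Δ.weight I.1 : R) *
      ∏ i ∈ I.1, (↑(z ^ (-(⌈(0 : ℝ) * Δ.coord h I i l⌉ - 1))) +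
        if 0 < Δ.coord h I i l then floorJump z ((0 : ℝ) * Δ.coord h I i l) else 0) := by
  classical
  rw [combGenus, map_sum]
  refine Finset.sum_congr rfl fun I _ => ?_
  rw [map_mul, map_intCast, map_pow, map_neg, aeval_X, neg_neg, ← Finset.prod_const,
    Finset.prod_filter]
  refine congrArg _ (Finset.prod_congr rfl fun i hi => ?_)
  rcases (hl.coord_ne_zero h I hi).lt_or_gt with h0 | h0
  · simp [h0, h0.not_gt]
  · simp [h0, h0.not_gt, floorJump]

/-- The `T_y`-genus vanishes at `y = -ζ` for an `N`-th root of unity `ζ`, up to a factor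
`1 - ζ`. -/
theorem one_sub_mul_aeval_combGenus {R : Type*} [CommRing R] (h : Δ.IsNonSingular)
    (hc : Δ.IsComplete) {z : Rˣ} {N : ℕ} (hz : z ^ N = 1) {u : Module.Dual ℤ L}
    (hu : ∀ i : V, u (Δ.edge i) ≡ 1 [ZMOD N]) {l : L} (hl : Δ.IsGenericVector l)
    (hul : u l ≡ 1 [ZMOD N]) :
    (1 - (z : R)) * aeval (-(z : R)) (combGenus h l) = 0 := by
  have h0 := eventually_floorSum_eq (R := R) h hc hz hu hl 0
  rw [← aeval_combGenus h z hl] at h0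
  obtain ⟨c, hcst⟩ := exists_forall_eventually_eq fun s =>
    ⟨_, eventually_floorSum_eq (R := R) h hc hz hu hl s⟩
  obtain ⟨s, hs, hs'⟩ := (h0.and (hcst 0)).exists
  rw [← hs, hs']
  have hshift : Tendsto (fun t : ℝ => t + 1) (𝓝[≠] 0) (𝓝[≠] 1) := by
    refine tendsto_nhdsWithin_iff.2 ⟨?_, eventually_mem_nhdsWithin.mono fun t ht => ?_⟩
    · have := (continuous_add_const (1 : ℝ)).tendsto 0
      rw [zero_add] at this
      exact this.mono_left nhdsWithin_le_nhds
    · simpa using ht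
  obtain ⟨t, ht, ht'⟩ := ((hcst 0).and (hshift.eventually (hcst 1))).exists
  have h1 := floorSum_add_one h hz hu hul t
  rw [ht, ht'] at h1
  rw [sub_mul, one_mul, h1, sub_self]

/-! ### The conclusion -/

lemma geom_sum_dvd_of_one_sub_mul {N : ℕ} {q : ℤ[X]}
    (hq : (X ^ N - 1 : ℤ[X]) ∣ (1 - X) * q) : ∑ k ∈ Finset.range N, (X : ℤ[X]) ^ k ∣ q := by
  rw [← geom_sum_mul, mul_comm, ← neg_sub X 1, neg_mul, dvd_neg] at hq
  exact (mul_dvd_mul_iff_left (X_sub_C_ne_zero (1 : ℤ))).1 (by simpa using hq)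

/-- In `ℤ[X]/(X^N - 1)` the class of `X` is the universal `N`-th root of unity, and vanishing there
is divisibility by `X^N - 1`; the factor `X - 1` then cancels. -/
theorem geom_sum_dvd_combGenus_comp (h : Δ.IsNonSingular) (hc : Δ.IsComplete) {N : ℕ}
    (hN : 0 < N) {u : Module.Dual ℤ L} (hu : ∀ i : V, u (Δ.edge i) ≡ 1 [ZMOD N]) {l : L}
    (hl : Δ.IsGenericVector l) (hul : u l ≡ 1 [ZMOD N]) :
    ∑ k ∈ Finset.range N, (X : ℤ[X]) ^ k ∣ (combGenus h l).comp (-X) := by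
  refine geom_sum_dvd_of_one_sub_mul ?_
  set f : ℤ[X] := X ^ N - 1 with hf
  have hroot : AdjoinRoot.root f ^ N = 1 := by
    have h1 : AdjoinRoot.mk f f = 0 := AdjoinRoot.mk_self
    rwa [hf, map_sub, map_pow, map_one, AdjoinRoot.mk_X, sub_eq_zero] at h1
  obtain ⟨z, hz⟩ : IsUnit (AdjoinRoot.root f) := IsUnit.of_pow_eq_one hroot hN.ne'
  have hzN : z ^ N = 1 := by
    ext
    rw [Units.val_pow_eq_pow_val, hz, hroot, Units.val_one]
  have h1 := one_sub_mul_aeval_combGenus (R := AdjoinRoot f) h hc hzN hu hl hul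
  rw [← AdjoinRoot.mk_eq_zero, map_mul, map_sub, map_one, AdjoinRoot.mk_X,
    ← AdjoinRoot.aeval_eq, aeval_comp, map_neg, aeval_X, ← hz]
  exact h1

open Classical in
lemma combGenus_comp_neg_X (h : Δ.IsNonSingular) (l : L) :
    (combGenus h l).comp (-X) = ∑ I : Δ.facets, (Δ.weight I.1 : ℤ[X]) *
      X ^ (I.1.filter fun i => Δ.coord h I i l < 0).card := by
  rw [combGenus, Polynomial.sum_comp]
  refine Finset.sum_congr rfl fun I _ => ?_
  simp [mul_comp]

open Classical in
lemma coeff_combGenus_comp (h : Δ.IsNonSingular) (l : L) (k : ℕ) :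
    ((combGenus h l).comp (-X)).coeff k = ∑ I : Δ.facets,
      if (I.1.filter fun i => Δ.coord h I i l < 0).card = k then Δ.weight I.1 else 0 := by
  rw [combGenus_comp_neg_X, finsetSum_coeff]
  refine Finset.sum_congr rfl fun I _ => ?_
  rw [← C_eq_intCast, coeff_C_mul, coeff_X_pow]
  simp [eq_comm]

lemma natDegree_combGenus_comp_le (h : Δ.IsNonSingular) (l : L) :
    ((combGenus h l).comp (-X)).natDegree ≤ Module.finrank ℤ L := by
  classical
  rw [natDegree_le_iff_coeff_eq_zero]
  intro k hk
  rw [coeff_combGenus_comp]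
  refine Finset.sum_eq_zero fun I _ => if_neg fun h0 => ?_
  have h1 := Finset.card_filter_le I.1 fun i => Δ.coord h I i l < 0
  rw [(Δ.mem_facets.1 I.2).2] at h1
  omega

/-- Duality: the extreme coefficients of the `T_y`-genus agree up to sign. -/
lemma coeff_finrank_combGenus_comp (h : Δ.IsNonSingular) (hc : Δ.IsComplete) {l : L}
    (hl : Δ.IsGenericVector l) :
    ((combGenus h l).comp (-X)).coeff (Module.finrank ℤ L) =
      ((combGenus h l).comp (-X)).coeff 0 := by
  classical
  -- Passing to `-l` exchanges "all coordinates negative" with "none negative".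
  conv_rhs => rw [combGenus_eq_of_isGenericVector h hc hl hl.neg]
  rw [coeff_combGenus_comp, coeff_combGenus_comp]
  refine Finset.sum_congr rfl fun I _ => if_congr ?_ rfl rfl
  rw [← (Δ.mem_facets.1 I.2).2, Finset.card_filter_eq_iff, Finset.card_eq_zero,
    Finset.filter_eq_empty_iff]
  refine forall₂_congr fun i hi => ?_
  have := hl.coord_ne_zero h I hi
  rw [map_neg]
  omega

lemma monic_geom_sum_natDegree {N : ℕ} (hN : 0 < N) :
    (∑ k ∈ Finset.range N, (X : ℤ[X]) ^ k).Monic ∧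
      (∑ k ∈ Finset.range N, (X : ℤ[X]) ^ k).natDegree = N - 1 := by
  have h1 : (∑ k ∈ Finset.range N, (X : ℤ[X]) ^ k).Monic := monic_geom_sum_X hN.ne'
  refine ⟨h1, ?_⟩
  have h2 := congrArg natDegree (geom_sum_mul (X : ℤ[X]) N)
  rw [← C_1, (h1.natDegree_mul (monic_X_sub_C 1)), natDegree_X_sub_C,
    natDegree_X_pow_sub_C] at h2
  omega

/-- The algebraic endgame: a polynomial of degree at most `n` with equal nonzero extreme
coefficients divisible by `1 + X + ⋯ + X ^ (N - 1)`. -/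
lemma eq_of_geom_sum_dvd {n N : ℕ} (hN : 0 < N) {q : ℤ[X]} (hdeg : q.natDegree ≤ n)
    (hcoeff : q.coeff n = q.coeff 0) (h0 : q.coeff 0 ≠ 0)
    (hdvd : ∑ k ∈ Finset.range N, (X : ℤ[X]) ^ k ∣ q) :
    N ≤ n + 1 ∧
      (N = n + 1 → q = C (q.coeff 0) * ∑ k ∈ Finset.range (n + 1), X ^ k) ∧
      (N = n → q = C (q.coeff 0) * (1 + X) * ∑ k ∈ Finset.range n, X ^ k) := by
  obtain ⟨hmon, hnat⟩ := monic_geom_sum_natDegree hN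
  obtain ⟨r, hr⟩ := hdvd
  have hqn : q.natDegree = n := le_antisymm hdeg (le_natDegree_of_ne_zero (hcoeff ▸ h0))
  have hr0 : r ≠ 0 := by
    rintro rfl
    rw [mul_zero] at hr
    rw [hr, coeff_zero] at h0
    exact h0 rfl
  have hsum : n = (N - 1) + r.natDegree := by
    rw [← hqn, hr, hmon.natDegree_mul' hr0, hnat]
  have hlead : r.coeff r.natDegree = q.coeff 0 := by
    have h1 : q.leadingCoeff = r.leadingCoeff := by rw [hr, leadingCoeff_monic_mul hmon]
    rw [leadingCoeff, leadingCoeff, hqn, hcoeff] at h1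
    exact h1.symm
  have hconst : r.coeff 0 = q.coeff 0 := by
    have h1 : (∑ k ∈ Finset.range N, (X : ℤ[X]) ^ k).coeff 0 = 1 := by
      rw [finsetSum_coeff]
      simp [coeff_X_pow, hN]
    rw [hr, mul_coeff_zero, h1, one_mul]
  refine ⟨by omega, fun hNn => ?_, fun hNn => ?_⟩
  · have hr1 : r.natDegree = 0 := by omega
    have h1 := eq_C_of_natDegree_eq_zero hr1
    rw [hconst] at h1
    conv_lhs => rw [hr, h1, hNn, mul_comm]
  · have hr1 : r.natDegree = 1 := by omega
    have h1 := eq_X_add_C_of_natDegree_le_one hr1.le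
    rw [hr1] at hlead
    rw [hconst, hlead] at h1
    conv_lhs => rw [hr, h1, hNn]
    ring

end SimplicialMultiFan

theorem mainTheorem7 {L : Type*} [AddCommGroup L] [Module.Free ℤ L] [Module.Finite ℤ L]
    (n : ℕ) (hn : Module.finrank ℤ L = n) (hn_pos : 1 ≤ n) {V : Type*} [Fintype V]
    (Δ : SimplicialMultiFan L V) (hcomplete : Δ.IsComplete) (hns : Δ.IsNonSingular) :
    -- the equivariant genus is constant, so that `T_y[Δ]` is well defined
    (Δ.IsTyGenus hns (Δ.tyGenus hns) ∧ ∀ P : ℤ[X], Δ.IsTyGenus hns P → P = Δ.tyGenus hns) ∧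
    (Δ.toddGenus hns ≠ 0 →
      ∀ N : ℕ, 0 < N → Δ.ChernClassDivisibleBy N →
        N ≤ n + 1 ∧
        (N = n + 1 →
          Δ.tyGenus hns = C (Δ.toddGenus hns) * ∑ k ∈ Finset.range (n + 1), (-X) ^ k) ∧
        (N = n →
          Δ.tyGenus hns = C (Δ.toddGenus hns) * (1 - X) * ∑ k ∈ Finset.range n, (-X) ^ k)) := by
  subst hn
  obtain ⟨I, hI, hIc⟩ := Δ.exists_facet
  let I' : Δ.facets := ⟨I, Δ.mem_facets.2 ⟨hI, hIc⟩⟩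
  obtain ⟨i, hi⟩ : I.Nonempty := Finset.card_pos.1 (hIc ▸ hn_pos)
  -- Staying in the coset of an edge vector modulo `N L` guarantees `⟨u, l⟩ ≡ ⟨u, v_i⟩ ≡ 1` mod `N`.
  have hex : ∀ N : ℕ, 0 < N → ∃ z : L, Δ.IsGenericVector (Δ.edge i + (N : ℤ) • z) := fun N hN =>
    (Δ.exists_isGenericVector (SimplicialMultiFan.coord_ne_zero hns I' hi) (Δ.edge i)
      (Int.natCast_ne_zero.2 hN.ne')).imp fun _ hz => hz.1
  refine ⟨?_, fun hT N hN hdiv => ?_⟩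
  · obtain ⟨z, hz⟩ := hex 1 one_pos
    have hgen := SimplicialMultiFan.isTyGenus_combGenus hns hcomplete hz
    rw [hgen.tyGenus_eq]
    exact ⟨hgen, fun P hP => hP.unique hgen⟩
  · obtain ⟨u, hu⟩ := hdiv.exists_dual
    obtain ⟨z, hz⟩ := hex N hN
    set l := Δ.edge i + (N : ℤ) • z with hl
    have hul : u l ≡ 1 [ZMOD N] := by
      rw [hl, map_add, map_smul, smul_eq_mul]
      simpa using (hu i).add (Int.modEq_zero_iff_dvd.2 (dvd_mul_right (N : ℤ) (u z)))
    have hgen := (SimplicialMultiFan.isTyGenus_combGenus hns hcomplete hz).tyGenus_eq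
    set q := (SimplicialMultiFan.combGenus hns l).comp (-X) with hq
    have hqT : Δ.tyGenus hns = q.comp (-X) := by
      rw [hgen, hq, comp_assoc]
      simp
    have hq0 : q.coeff 0 = Δ.toddGenus hns := by
      rw [SimplicialMultiFan.toddGenus, hgen, hq, coeff_zero_eq_eval_zero, eval_comp]
      simp
    obtain ⟨h1, h2, h3⟩ := SimplicialMultiFan.eq_of_geom_sum_dvd hN
      (SimplicialMultiFan.natDegree_combGenus_comp_le hns l)
      (SimplicialMultiFan.coeff_finrank_combGenus_comp hns hcomplete hz) (hq0.trans_ne hT)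
      (SimplicialMultiFan.geom_sum_dvd_combGenus_comp hns hcomplete hN hu hz hul)
    rw [← hq, hq0] at h2 h3
    refine ⟨h1, fun h => ?_, fun h => ?_⟩
    · rw [hqT, h2 h, mul_comp, C_comp, Polynomial.sum_comp]
      simp
    · rw [hqT, h3 h, mul_comp, mul_comp, C_comp, Polynomial.sum_comp]
      simp [sub_eq_add_neg]

end
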